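/- Fix a finite set $A$ (an alphabet of unary modalities $\Diamond$). Modal formulas over $A$ are built from variables $p_0,p_1,\dots$ by Boolean connectives and the $\Diamond\in A$; $\Box\varphi=\neg\Diamond\neg\varphi$. A (normal) logic over $A$ is a set of formulas that contains all classical tautologies, $\neg\Diamond\bot$ and $\Diamond(p_0\vee p_1)\to\Diamond p_0\vee\Diamond p_1$ for $\Diamond\in A$, and is closed under modus ponens, substitution, and monotonicity (from $\varphi\to\psi$ infer $\Diamond\varphi\to\Diamond\psi$). An extension of a logic is a logic over the same alphabet that contains it. A logic $L$ is locally tabular if for each $k<\omega$ there are, up to equivalence $\varphi\leftrightarrow\psi\in L$, only finitely many formulas in the variables $p_i$, $i<k$. For $B\subseteq A$, let $L^{\restriction B}$ be the set of formulas over $B$ that are in $L$. Put $\Diamond_A\varphi=\bigvee_{\Diamond\in A}\Diamond\varphi$ and $\Diamond_A^{\le m}\varphi=\bigvee_{i\le m}\Diamond_A^i\varphi$. The transitivity index of $L$ is the least $m<\omega$ with $\Diamond_A^{m+1}p\to\Diamond_A^{\le m}p\in L$, and $\omega$ if there is none. Let $B_0=\bot$ and $B_h=p_h\to\Box(\Diamond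 p_h\vee B_{h-1})$ for $h\geq 1$. If the transitivity index $m$ of $L$ is finite, the height of $L$ is the least $h<\omega$ with $B_h^*\in L$, where $B_h^*$ is $B_h$ with every $\Diamond$ replaced by $\Diamond_A^{\le m}$, and $\omega$ if there is no such $h$; if the transitivity index is $\omega$, the height is $\omega$. A logic $L_0$ over $A$ admits the finite height criterion if for each extension $L$ of $L_0$: $L$ is locally tabular if and only if the height of $L^{\restriction B}$ (a logic over $B$) is finite for each $B\subseteq A$. For a logic $L$ over $A$, let $L^{\neq}$ be the smallest logic over $A\cup\{\langle\neq\rangle\}$, with $\langle\neq\rangle$ a new modality and $[\neq]=\neg\langle\neq\rangle\neg$, that contains $L$ and the formulas $$p\to[\neq]\langle\neq\rangle p,\qquad \langle\neq\rangle\langle\neq\rangle p\to\langle\neq\rangle p\vee p,\qquad \Diamond p\to\langle\neq\rangle p\vee p\ \ (\Diamond\in A).$$ Then for every finite alphabet $A$ and every logic $L$ over $A$, $L^{\neq}$ admits the finite height criterion if and only if $L$ does. In particular, for every $m>0$, $L_m^{\neq}$ admits the finite height criterion, where $L_m$ is the smallest unimodal logic containing $\Diamond^{m+1}p\to\Diamond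 p\vee p$. -/

import Mathlib

universe u v

namespace ModalFH

/-- Modal formulas over the alphabet `A` of modalities, with variables `p₀, p₁, …`.
The remaining Boolean connectives are defined from `⊥` and `→`. -/
inductive Formula (A : Type u) : Type u
  | var : ℕ → Formula A
  | bot : Formula A
  | imp : Formula A → Formula A → Formula A
  | dia : A → Formula A → Formula A

namespace Formula

def neg {A : Type u} (φ : Formula A) : Formula A := imp φ bot

def or {A : Type u} (φ ψ : Formula A) : Formula A := imp (neg φ) ψ

def and {A : Type u} (φ ψ : Formula A) : Formula A := neg (imp φ (neg ψ))

def iff {A : Type u} (φ ψ : Formula A) : Formula A := and (imp φ ψ) (imp ψ φ)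

def box {A : Type u} (a : A) (φ : Formula A) : Formula A := neg (dia a (neg φ))

/-- The disjunction of a finite list of formulas; the empty disjunction is `⊥`. -/
def disj {A : Type u} (l : List (Formula A)) : Formula A := l.foldr or bot

/-- Uniform substitution of `σ n` for the variable `p_n`. -/
def subst {A : Type u} (σ : ℕ → Formula A) : Formula A → Formula A
  | var n => σ n
  | bot => bot
  | imp φ ψ => imp (subst σ φ) (subst σ ψ)
  | dia a φ => dia a (subst σ φ)

/-- Renaming of modalities; used for inclusions of alphabets. -/
def map {A : Type u} {B : Type v} (f : A → B) : Formula A → Formula B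
  | var n => var n
  | bot => bot
  | imp φ ψ => imp (map f φ) (map f ψ)
  | dia a φ => dia (f a) (map f φ)

/-- `φ` is a `k`-formula: all its variables are among the `p_i` with `i < k`. -/
def IsKFormula {A : Type u} (k : ℕ) : Formula A → Prop
  | var n => n < k
  | bot => True
  | imp φ ψ => IsKFormula k φ ∧ IsKFormula k ψ
  | dia _ φ => IsKFormula k φ

/-- Classical tautologies in the modal language: formulas true under every assignment of truth
values that respects the Boolean connectives (variables and formulas `◇ψ` are treated as atoms). -/
def IsTautology {A : Type u} (φ : Formula A) : Prop :=
  ∀ t : Formula A → Prop, ¬ t bot → (∀ ψ χ, t (imp ψ χ) ↔ (t ψ → t χ)) → t φ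

/-- `◇_A φ`, the disjunction of all `◇φ` with `◇ ∈ A`. -/
noncomputable def diaAll {A : Type u} [Fintype A] (φ : Formula A) : Formula A :=
  disj ((Finset.univ : Finset A).toList.map fun a => dia a φ)

/-- `◇_A^{≤ m} φ`, the disjunction of the `◇_A^i φ` with `i ≤ m`. -/
noncomputable def diaLe {A : Type u} [Fintype A] (m : ℕ) (φ : Formula A) : Formula A :=
  disj ((List.range (m + 1)).map fun i => diaAll^[i] φ)

/-- The formula of `m`-transitivity `◇_A^{m+1} p → ◇_A^{≤ m} p`. -/
noncomputable def tr (A : Type u) [Fintype A] (m : ℕ) : Formula A :=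
  imp (diaAll^[m + 1] (var 0)) (diaLe m (var 0))

/-- The unimodal formulas of finite height: `B₀ = ⊥`, `B_h = p_h → □(◇p_h ∨ B_{h-1})`. -/
def heightFormula : ℕ → Formula Unit
  | 0 => bot
  | h + 1 => imp (var (h + 1)) (box () (or (dia () (var (h + 1))) (heightFormula h)))

/-- Replacement of each occurrence of `◇` in a unimodal formula by `◇_A^{≤ m}`. -/
noncomputable def starForm {A : Type u} [Fintype A] (m : ℕ) : Formula Unit → Formula A
  | var n => var n
  | bot => bot
  | imp φ ψ => imp (starForm m φ) (starForm m ψ)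
  | dia _ φ => diaLe m (starForm m φ)

end Formula

open Formula

/-- Normal modal logics over `A`. -/
structure IsLogic {A : Type u} (L : Set (Formula A)) : Prop where
  taut : ∀ φ, IsTautology φ → φ ∈ L
  dia_bot : ∀ a, neg (dia a bot) ∈ L
  dia_or : ∀ a, imp (dia a (or (var 0) (var 1))) (or (dia a (var 0)) (dia a (var 1))) ∈ L
  mp : ∀ φ ψ, imp φ ψ ∈ L → φ ∈ L → ψ ∈ L
  subst : ∀ (σ : ℕ → Formula A) (φ), φ ∈ L → φ.subst σ ∈ L
  mono : ∀ a φ ψ, imp φ ψ ∈ L → imp (dia a φ) (dia a ψ) ∈ L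

/-- The smallest normal logic over `A` that contains `Φ`. -/
def smallestLogic {A : Type u} (Φ : Set (Formula A)) : Set (Formula A) :=
  ⋂₀ {L | IsLogic L ∧ Φ ⊆ L}

/-- `L` is `k`-finite: there are finitely many `k`-formulas up to equivalence in `L`
(finitely many equivalence classes, i.e. elements of the Lindenbaum algebra). -/
def KFinite {A : Type u} (L : Set (Formula A)) (k : ℕ) : Prop :=
  {C : Set (Formula A) | ∃ φ, IsKFormula k φ ∧
    C = {ψ | IsKFormula k ψ ∧ iff φ ψ ∈ L}}.Finite

def LocallyTabular {A : Type u} (L : Set (Formula A)) : Prop := ∀ k, KFinite L k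

/-- The transitivity index of `L`: the least `m` such that `L` contains the formula of
`m`-transitivity, and `⊤` if there is no such `m`. -/
noncomputable def transIndex {A : Type u} [Fintype A] (L : Set (Formula A)) : ℕ∞ :=
  sInf {x | ∃ m : ℕ, tr A m ∈ L ∧ x = m}

open Classical in
/-- The height of `L`: for a pretransitive logic, the least `h` such that `B_h^* ∈ L`, where `◇^*`
is `◇_A^{≤ m}` with `m` the transitivity index of `L`, and `⊤` if there is no such `h`;
for any other logic, `⊤`. -/
noncomputable def height {A : Type u} [Fintype A] (L : Set (Formula A)) : ℕ∞ :=
  if transIndex L = ⊤ then ⊤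
  else sInf {x | ∃ h : ℕ, starForm (transIndex L).toNat (heightFormula h) ∈ L ∧ x = h}

/-- The restriction of `L` to the subalphabet `B`: the formulas over `B` that are in `L`. -/
def restrict {A : Type u} (L : Set (Formula A)) (B : Finset A) : Set (Formula B) :=
  {φ | φ.map Subtype.val ∈ L}

/-- `L₀` admits the finite height criterion: each extension `L` of `L₀` is locally tabular iff all
its restrictions to subalphabets have finite height. -/
def AdmitsFiniteHeightCriterion {A : Type u} [Fintype A] (L₀ : Set (Formula A)) : Prop :=
  ∀ L : Set (Formula A), IsLogic L → L₀ ⊆ L →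
    (LocallyTabular L ↔ ∀ B : Finset A, height (restrict L B) < ⊤)

/-- Axioms of the difference modality `none` over the alphabet `Option A`. -/
inductive DiffAxiom (A : Type u) : Formula (Option A) → Prop
  | symm : DiffAxiom A (imp (var 0) (box none (dia none (var 0))))
  | trans : DiffAxiom A (imp (dia none (dia none (var 0))) (or (dia none (var 0)) (var 0)))
  | incl (a : A) : DiffAxiom A (imp (dia (some a) (var 0)) (or (dia none (var 0)) (var 0)))

/-- The expansion of `L` with the difference modality, over `A` enriched with the new symbol
`none`. -/
def diff {A : Type u} (L : Set (Formula A)) : Set (Formula (Option A)) :=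
  smallestLogic (Formula.map some '' L ∪ {φ | DiffAxiom A φ})

/-- `L_m`, the smallest unimodal logic containing `◇^{m+1} p → ◇p ∨ p`. -/
def logicLm (m : ℕ) : Set (Formula Unit) :=
  smallestLogic {imp ((dia ())^[m + 1] (var 0)) (or (dia () (var 0)) (var 0))}

end ModalFH

/-! Local tabularity always implies finite height of every restriction
(`LocallyTabular.height_restrict_lt_top`), so only the converse half of the criterion has to be
transferred. Logics are studied through their canonical frames, whose points are the truth
assignments satisfying the logic.

The transfer compares an extension `M` of `diff L` with its reduct `pull some M`, an extension of
`L`. Heights agree up to finiteness: if a subalphabet contains `⟨≠⟩`, reachability is contained in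
`R_≠ ∪ id`, which is symmetric, so the restriction has finite height automatically; the other
subalphabets come from `A`. Local tabularity passes to reducts trivially. It lifts from them
(`LocallyTabular.of_pull_some`) because, on a component of the canonical frame, `⟨≠⟩φ` is equivalent
to `⊥`, `⊤` or `¬φ`; thus `⟨≠⟩` acts on the finitely many classes of `⟨≠⟩`-free `k`-formulas as one
of finitely many maps. Finally every extension `N` of `L` occurs as a reduct, since `diff N` is
conservative over `N` (`pull_diff`): the universal modality satisfies the axioms for `⟨≠⟩`.

For `L_m` the canonical relation satisfies `R^(m+1) ⊆ R ∪ id`. A cluster of such a frame either has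
at most `m + 1` points or is saturated: walks of length `≡ 1 (mod m)` between distinct points reduce
to edges (`saturated_or_small`). In a saturated cluster, finite data, namely the colours that occur
at each distance modulo `m`, determine a point up to bisimilarity. Finite height is canonical, so an
induction over the layers of the canonical frame gives finitely many bisimilarity types for each
`k`, hence local tabularity. -/

namespace ModalFH

open Formula

/-! ### Canonical worlds -/

/-- A world of `L`: a Boolean truth assignment on formulas that makes all of `L` true. -/
@[ext] structure World {A : Type u} (L : Set (Formula A)) where
  holds : Formula A → Prop
  not_bot : ¬ holds bot
  holds_imp' : ∀ φ ψ, holds (imp φ ψ) ↔ (holds φ → holds ψ)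
  of_mem : ∀ φ ∈ L, holds φ

section Basic

variable {A : Type u} {L : Set (Formula A)}

namespace World

variable (w : World L)

@[simp] lemma holds_bot : w.holds bot ↔ False := iff_of_false w.not_bot id

@[simp] lemma holds_imp (φ ψ : Formula A) : w.holds (imp φ ψ) ↔ (w.holds φ → w.holds ψ) :=
  w.holds_imp' φ ψ

@[simp] lemma holds_neg (φ : Formula A) : w.holds (neg φ) ↔ ¬ w.holds φ := by simp [neg]

@[simp] lemma holds_or (φ ψ : Formula A) : w.holds (φ.or ψ) ↔ (w.holds φ ∨ w.holds ψ) := by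
  simp [Formula.or]; tauto

@[simp] lemma holds_and (φ ψ : Formula A) : w.holds (φ.and ψ) ↔ (w.holds φ ∧ w.holds ψ) := by
  simp [Formula.and]

@[simp] lemma holds_iff (φ ψ : Formula A) : w.holds (φ.iff ψ) ↔ (w.holds φ ↔ w.holds ψ) := by
  simp [Formula.iff]; tauto

@[simp] lemma holds_disj (l : List (Formula A)) : w.holds (disj l) ↔ ∃ φ ∈ l, w.holds φ := by
  induction l with
  | nil => simp [disj]
  | cons φ l ih =>
    have : disj (φ :: l) = φ.or (disj l) := rfl
    simp [this, ih]

/-- The canonical accessibility relation of the modality `a`. -/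
def Rel (a : A) (w v : World L) : Prop := ∀ φ, v.holds φ → w.holds (dia a φ)

end World

/-- A set of formulas that contains the tautologies and is closed under modus ponens is an
intersection of Boolean truth assignments. -/
lemma exists_world_of_notMem (hL : IsLogic L) {Γ : Set (Formula A)} (hΓ : L ⊆ Γ)
    (mp : ∀ φ ψ, imp φ ψ ∈ Γ → φ ∈ Γ → ψ ∈ Γ) {φ : Formula A} (hφ : φ ∉ Γ) :
    ∃ w : World L, (∀ ψ ∈ Γ, w.holds ψ) ∧ ¬ w.holds φ := by
  let S : Set (Set (Formula A)) :=
    {Δ | L ⊆ Δ ∧ (∀ α β, imp α β ∈ Δ → α ∈ Δ → β ∈ Δ) ∧ φ ∉ Δ}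
  obtain ⟨Δ, hΓΔ, hmax⟩ := zorn_subset_nonempty S (by
    intro c hc hchain hne
    obtain ⟨Δ₀, hΔ₀⟩ := hne
    refine ⟨⋃₀ c, ⟨fun x hx => ⟨Δ₀, hΔ₀, (hc hΔ₀).1 hx⟩, ?_, ?_⟩,
      fun s hs => Set.subset_sUnion_of_mem hs⟩
    · rintro α β ⟨s, hs, h1⟩ ⟨t, ht, h2⟩
      rcases hchain.total hs ht with h | h
      · exact ⟨t, ht, (hc ht).2.1 α β (h h1) h2⟩
      · exact ⟨s, hs, (hc hs).2.1 α β h1 (h h2)⟩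
    · rintro ⟨s, hs, h1⟩
      exact (hc hs).2.2 h1) Γ ⟨hΓ, mp, hφ⟩
  obtain ⟨⟨hLΔ, hmp, hφΔ⟩, hmax⟩ := hmax
  have taut : ∀ ψ, IsTautology ψ → ψ ∈ Δ := fun ψ h => hLΔ (hL.taut ψ h)
  -- `Δ` is maximal among the theories omitting `φ`, so the theory generated by `Δ` and `ψ`, namely
  -- `{χ | ψ → χ ∈ Δ}`, must contain `φ`.
  have key : ∀ ψ, ψ ∉ Δ → imp ψ φ ∈ Δ := by
    intro ψ hψ
    by_contra hcon
    refine hψ (hmax (y := {χ | imp ψ χ ∈ Δ}) ⟨?_, ?_, hcon⟩ ?_ ?_)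
    · intro χ hχ
      exact hmp χ _ (taut _ fun t _ hi => by simp only [hi]; tauto) (hLΔ hχ)
    · intro α β h1 h2
      exact hmp _ _ (hmp (imp ψ (imp α β)) _
        (taut _ fun t _ hi => by simp only [hi]; tauto) h1) h2
    · intro χ hχ
      exact hmp χ _ (taut _ fun t _ hi => by simp only [hi]; tauto) hχ
    · exact taut _ fun t _ hi => by simp only [hi]; tauto
  refine ⟨⟨(· ∈ Δ), ?_, ?_, fun ψ h => hLΔ h⟩, fun ψ h => hΓΔ h, hφΔ⟩
  · intro h
    exact hφΔ (hmp bot _ (taut _ fun t hb hi => by simp only [hi]; tauto) h)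
  · intro α β
    refine ⟨hmp α β, fun h => ?_⟩
    by_contra hn
    have h1 := key _ hn
    by_cases hα : α ∈ Δ
    · exact hn (hmp β _ (taut _ fun t hb hi => by simp only [hi]; tauto) (h hα))
    · exact hφΔ (hmp _ _ (hmp (imp (imp α β) φ) (imp (imp α φ) φ)
        (taut _ fun t hb hi => by simp only [hi]; tauto) h1) (key _ hα))

lemma mem_iff_forall_world (hL : IsLogic L) {φ : Formula A} :
    φ ∈ L ↔ ∀ w : World L, w.holds φ := by
  refine ⟨fun h w => w.of_mem φ h, fun h => ?_⟩
  by_contra hn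
  obtain ⟨w, -, hw⟩ := exists_world_of_notMem hL subset_rfl hL.mp hn
  exact hw (h w)

lemma World.dia_mono (hL : IsLogic L) {w : World L} {a : A} {φ ψ : Formula A}
    (h : ∀ v : World L, v.holds φ → v.holds ψ) (hw : w.holds (dia a φ)) : w.holds (dia a ψ) := by
  have : imp φ ψ ∈ L := (mem_iff_forall_world hL).2 fun v => by simpa using h v
  simpa using (w.holds_imp _ _).1 (w.of_mem _ (hL.mono a φ ψ this)) hw

lemma World.dia_or (hL : IsLogic L) {w : World L} {a : A} {φ ψ : Formula A}
    (hw : w.holds (dia a (φ.or ψ))) : w.holds (dia a φ) ∨ w.holds (dia a ψ) := by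
  have h := w.of_mem _ (hL.subst (fun n => if n = 0 then φ else ψ) _ (hL.dia_or a))
  have h' : w.holds (imp (dia a (φ.or ψ)) ((dia a φ).or (dia a ψ))) := h
  rw [World.holds_imp, World.holds_or] at h'
  exact h' hw

lemma World.not_dia_of_forall (hL : IsLogic L) {w : World L} {a : A} {φ : Formula A}
    (h : ∀ v : World L, ¬ v.holds φ) : ¬ w.holds (dia a φ) := fun hw => by
  have h1 := w.of_mem _ (hL.dia_bot a)
  rw [World.holds_neg] at h1
  exact h1 (World.dia_mono hL (fun v hv => (h v hv).elim) hw)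

/-- A form of compactness: if `◇φ` for a family of formulas closed under conjunction is true
at `w`, then they are jointly true at an accessible world. -/
lemma World.exists_rel_of_directed (hL : IsLogic L) (w : World L) (a : A) (Δ : Set (Formula A))
    (hne : Δ.Nonempty)
    (hdir : ∀ φ ∈ Δ, ∀ ψ ∈ Δ, ∃ χ ∈ Δ, ∀ v : World L, v.holds χ → v.holds φ ∧ v.holds ψ)
    (h : ∀ φ ∈ Δ, w.holds (dia a φ)) :
    ∃ v : World L, Rel a w v ∧ ∀ φ ∈ Δ, v.holds φ := by
  -- Membership of `ψ` says that `□(φ → ψ)` is true at `w` for some `φ ∈ Δ`. Directedness of `Δ`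
  -- gives closure under modus ponens, and any world satisfying `Γ` is a suitable successor.
  let Γ : Set (Formula A) := {ψ | ∃ φ ∈ Δ, ¬ w.holds (dia a (φ.and ψ.neg))}
  have hbot : bot ∉ Γ := by
    rintro ⟨φ, hφ, hn⟩
    exact hn (World.dia_mono hL (by simp) (h φ hφ))
  have hLΓ : L ⊆ Γ := by
    intro ψ hψ
    obtain ⟨σ, hσ⟩ := hne
    refine ⟨σ, hσ, World.not_dia_of_forall hL fun v => ?_⟩
    simp [v.of_mem _ hψ]
  have hmp : ∀ α β, imp α β ∈ Γ → α ∈ Γ → β ∈ Γ := by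
    rintro α β ⟨φ, hφ, h1⟩ ⟨ψ, hψ, h2⟩
    obtain ⟨χ, hχ, hχ'⟩ := hdir φ hφ ψ hψ
    refine ⟨χ, hχ, fun h3 => ?_⟩
    have : w.holds (dia a ((φ.and (imp α β).neg).or (ψ.and α.neg))) :=
      World.dia_mono hL (fun v hv => by
        have := hχ' v
        simp at hv ⊢; tauto) h3
    exact (World.dia_or hL this).elim h1 h2
  obtain ⟨v, hv, -⟩ := exists_world_of_notMem hL hLΓ hmp hbot
  refine ⟨v, fun φ hφ => ?_, fun φ hφ => hv φ ⟨φ, hφ, World.not_dia_of_forall hL (by simp)⟩⟩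
  by_contra hn
  obtain ⟨σ, hσ⟩ := hne
  have := hv φ.neg ⟨σ, hσ, fun h' => hn (World.dia_mono hL (by simp) h')⟩
  simp [hφ] at this

lemma World.holds_dia (hL : IsLogic L) (w : World L) (a : A) (φ : Formula A) :
    w.holds (dia a φ) ↔ ∃ v : World L, Rel a w v ∧ v.holds φ := by
  constructor
  · intro h
    obtain ⟨v, h1, h2⟩ := w.exists_rel_of_directed hL a {φ} (by simp) (by simp) (by simpa using h)
    exact ⟨v, h1, by simpa using h2⟩
  · rintro ⟨v, h1, h2⟩
    exact h1 φ h2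

/-! ### Iterations of the joint accessibility relation -/

/-- `n`-fold composition of a relation with itself. -/
def iter {X : Type*} (R : X → X → Prop) : ℕ → X → X → Prop
  | 0, x, y => x = y
  | n + 1, x, y => ∃ z, R x z ∧ iter R n z y

lemma iter_add {X : Type*} {R : X → X → Prop} {a b : ℕ} {x y z : X} (h : iter R a x y)
    (h' : iter R b y z) : iter R (a + b) x z := by
  induction a generalizing x with
  | zero => obtain rfl : x = y := h; simpa using h'
  | succ a ih =>
    obtain ⟨u, h1, h2⟩ := h
    rw [show a + 1 + b = (a + b) + 1 by omega]
    exact ⟨u, h1, ih h2⟩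

lemma iter_one {X : Type*} {R : X → X → Prop} {x y : X} : iter R 1 x y ↔ R x y := by
  simp [iter]

lemma reflTransGen_iff_iter {X : Type*} {R : X → X → Prop} {x y : X} :
    Relation.ReflTransGen R x y ↔ ∃ n, iter R n x y := by
  constructor
  · intro h
    induction h with
    | refl => exact ⟨0, rfl⟩
    | tail _ h ih => obtain ⟨n, hn⟩ := ih; exact ⟨n + 1, iter_add hn (iter_one.2 h)⟩
  · rintro ⟨n, hn⟩
    induction n generalizing x with
    | zero => obtain rfl : x = y := hn; exact .refl
    | succ n ih => obtain ⟨z, h1, h2⟩ := hn; exact .head h1 (ih h2)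

/-- The union of the canonical accessibility relations. -/
def RelAll (w v : World L) : Prop := ∃ a, World.Rel a w v

/-- Reachability in the canonical frame. -/
abbrev Reach : World L → World L → Prop := Relation.ReflTransGen RelAll

lemma subst_disj (σ : ℕ → Formula A) (l : List (Formula A)) :
    (disj l).subst σ = disj (l.map (subst σ)) := by
  induction l with
  | nil => rfl
  | cons φ l ih =>
    simp only [disj, List.foldr_cons, List.map_cons] at ih ⊢
    rw [← ih]; rfl

end Basic

/-! ### The joint modality of a finite alphabet, its iterates and reachability. -/

section Fintype

variable {A : Type u} [Fintype A] {L : Set (Formula A)}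

lemma World.holds_diaAll_iff (w : World L) (φ : Formula A) :
    w.holds (diaAll φ) ↔ ∃ a, w.holds (dia a φ) := by
  simp [diaAll]

lemma World.holds_diaAll (hL : IsLogic L) (w : World L) (φ : Formula A) :
    w.holds (diaAll φ) ↔ ∃ v : World L, RelAll w v ∧ v.holds φ := by
  simp only [holds_diaAll_iff, World.holds_dia hL, RelAll]
  exact ⟨fun ⟨a, v, h⟩ => ⟨v, ⟨a, h.1⟩, h.2⟩, fun ⟨v, ⟨a, h1⟩, h2⟩ => ⟨a, v, h1, h2⟩⟩

lemma World.holds_diaAll_iterate (hL : IsLogic L) (n : ℕ) (w : World L) (φ : Formula A) :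
    w.holds (diaAll^[n] φ) ↔ ∃ v : World L, iter RelAll n w v ∧ v.holds φ := by
  induction n generalizing w with
  | zero => simp [iter]
  | succ n ih =>
    rw [Function.iterate_succ_apply', World.holds_diaAll hL]
    simp only [ih, iter]
    exact ⟨fun ⟨v, h, u, h'⟩ => ⟨u, ⟨v, h, h'.1⟩, h'.2⟩, fun ⟨u, ⟨v, h, h'⟩, h2⟩ => ⟨v, h, u, h', h2⟩⟩

lemma World.holds_diaLe_iff (n : ℕ) (w : World L) (φ : Formula A) :
    w.holds (diaLe n φ) ↔ ∃ i ≤ n, w.holds (diaAll^[i] φ) := by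
  simp only [diaLe, holds_disj, List.mem_map, List.mem_range, Nat.lt_succ_iff]
  exact ⟨fun ⟨_, ⟨i, hi, h⟩, h'⟩ => ⟨i, hi, h ▸ h'⟩, fun ⟨i, hi, h⟩ => ⟨_, ⟨i, hi, rfl⟩, h⟩⟩

lemma World.holds_diaLe (hL : IsLogic L) (n : ℕ) (w : World L) (φ : Formula A) :
    w.holds (diaLe n φ) ↔ ∃ v : World L, (∃ i ≤ n, iter RelAll i w v) ∧ v.holds φ := by
  simp only [holds_diaLe_iff, World.holds_diaAll_iterate hL]
  exact ⟨fun ⟨i, hi, v, h, h'⟩ => ⟨v, ⟨i, hi, h⟩, h'⟩, fun ⟨v, ⟨i, hi, h⟩, h'⟩ => ⟨i, hi, v, h, h'⟩⟩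

lemma subst_diaAll (σ : ℕ → Formula A) (φ : Formula A) :
    (diaAll φ).subst σ = diaAll (φ.subst σ) := by
  simp only [diaAll, subst_disj, List.map_map]; rfl

lemma subst_diaAll_iterate (σ : ℕ → Formula A) (n : ℕ) (φ : Formula A) :
    (diaAll^[n] φ).subst σ = diaAll^[n] (φ.subst σ) := by
  induction n with
  | zero => rfl
  | succ n ih => simp only [Function.iterate_succ_apply', subst_diaAll, ih]

lemma subst_diaLe (σ : ℕ → Formula A) (n : ℕ) (φ : Formula A) :
    (diaLe n φ).subst σ = diaLe n (φ.subst σ) := by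
  simp only [diaLe, subst_disj, List.map_map]
  congr 1
  apply List.map_congr_left
  intro i _
  exact subst_diaAll_iterate σ i φ

/-- An `(n + 1)`-step witness can be shortened, so `◇^{≤ n}φ` propagates backwards along any path.
Consequently every `n` with `tr A n ∈ L` gives the same modality, and finiteness of height can be
tested with any such `n`. -/
lemma World.holds_diaLe_of_tr (hL : IsLogic L) {n : ℕ} (hn : tr A n ∈ L) (w : World L)
    (φ : Formula A) : w.holds (diaLe n φ) ↔ ∃ v : World L, Reach w v ∧ v.holds φ := by
  have step : ∀ w u : World L, RelAll w u → u.holds (diaLe n φ) → w.holds (diaLe n φ) := by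
    intro w u hwu hu
    rw [holds_diaLe_iff] at hu
    obtain ⟨i, hi, hu⟩ := hu
    have h1 : w.holds (diaAll^[i + 1] φ) := by
      rw [Function.iterate_succ_apply', World.holds_diaAll hL]
      exact ⟨u, hwu, hu⟩
    rcases hi.lt_or_eq with h | rfl
    · exact (holds_diaLe_iff _ _ _).2 ⟨i + 1, h, h1⟩
    · have h2 := w.of_mem _ (hL.subst (fun _ => φ) _ hn)
      rw [tr, subst, subst_diaAll_iterate, subst_diaLe, World.holds_imp] at h2
      exact h2 h1
  constructor
  · rw [World.holds_diaLe hL]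
    rintro ⟨v, ⟨i, -, h⟩, h'⟩
    exact ⟨v, reflTransGen_iff_iter.2 ⟨i, h⟩, h'⟩
  · rintro ⟨v, h, h'⟩
    induction h using Relation.ReflTransGen.head_induction_on with
    | refl => exact (holds_diaLe_iff _ _ _).2 ⟨0, by simp, h'⟩
    | head h1 _ ih => exact step _ _ h1 ih

/-- If each modality `a` failed on some member of `Δ`, then, the alphabet being finite, a single
member of `Δ` below all of these would refute the joint modality. -/
lemma relAll_of_forall_diaAll (hL : IsLogic L) {w : World L} {Δ : Set (Formula A)}
    (hne : Δ.Nonempty)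
    (hdir : ∀ φ ∈ Δ, ∀ ψ ∈ Δ, ∃ χ ∈ Δ, ∀ v : World L, v.holds χ → v.holds φ ∧ v.holds ψ)
    (h : ∀ φ ∈ Δ, w.holds (diaAll φ)) :
    ∃ v : World L, RelAll w v ∧ ∀ φ ∈ Δ, v.holds φ := by
  by_cases H : ∃ a, ∀ φ ∈ Δ, w.holds (dia a φ)
  · obtain ⟨a, ha⟩ := H
    obtain ⟨v, h1, h2⟩ := w.exists_rel_of_directed hL a Δ hne hdir ha
    exact ⟨v, ⟨a, h1⟩, h2⟩
  · push Not at H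
    choose f hf hf' using H
    have : ∀ s : Finset A, ∃ χ ∈ Δ, ∀ v : World L, v.holds χ → ∀ a ∈ s, v.holds (f a) := by
      intro s
      classical
      induction s using Finset.induction_on with
      | empty => exact ⟨hne.some, hne.some_mem, by simp⟩
      | insert a s _ ih =>
        obtain ⟨χ, h1, h2⟩ := ih
        obtain ⟨χ', h3, h4⟩ := hdir χ h1 (f a) (hf a)
        refine ⟨χ', h3, fun v hv b hb => ?_⟩
        rcases Finset.mem_insert.1 hb with rfl | hb
        · exact (h4 v hv).2
        · exact h2 v (h4 v hv).1 b hb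
    obtain ⟨χ, h1, h2⟩ := this Finset.univ
    obtain ⟨a, ha⟩ := (w.holds_diaAll_iff χ).1 (h χ h1)
    exact (hf' a (World.dia_mono hL (fun v hv => h2 v hv a (Finset.mem_univ a)) ha)).elim

lemma iter_of_forall_diaAll_iterate (hL : IsLogic L) (n : ℕ) {w v : World L}
    (h : ∀ φ, v.holds φ → w.holds (diaAll^[n] φ)) : iter RelAll n w v := by
  induction n generalizing w with
  | zero =>
    refine World.ext (funext fun φ => propext ⟨fun hw => ?_, h φ⟩)
    by_contra hv
    exact (w.holds_neg φ).1 (h φ.neg ((v.holds_neg φ).2 hv)) hw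
  | succ n ih =>
    obtain ⟨u, h1, h2⟩ := relAll_of_forall_diaAll hL (w := w)
      (Δ := (fun φ => diaAll^[n] φ) '' {φ | v.holds φ}) ⟨_, imp bot bot, by simp, rfl⟩ (by
        rintro _ ⟨φ, hφ, rfl⟩ _ ⟨ψ, hψ, rfl⟩
        refine ⟨_, ⟨φ.and ψ, by simpa using ⟨hφ, hψ⟩, rfl⟩, fun u hu => ?_⟩
        simp only [World.holds_diaAll_iterate hL, World.holds_and] at hu ⊢
        obtain ⟨x, h1, h2, h3⟩ := hu
        exact ⟨⟨x, h1, h2⟩, ⟨x, h1, h3⟩⟩) (by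
        rintro _ ⟨φ, hφ, rfl⟩
        have := h φ hφ
        rwa [Function.iterate_succ_apply'] at this)
    exact ⟨u, h1, ih fun φ hφ => h2 _ ⟨φ, hφ, rfl⟩⟩

/-- If `v` were unreachable, each `i` would have a formula true at `v` whose `i`-th joint iterate
fails at `w`; the conjunction of those with `i ≤ n` refutes `◇^{≤ n}`. -/
lemma reach_of_forall_diaLe (hL : IsLogic L) (n : ℕ) {w v : World L}
    (h : ∀ φ, v.holds φ → w.holds (diaLe n φ)) : Reach w v := by
  by_contra hcon
  have H : ∀ i, ∃ φ, v.holds φ ∧ ¬ w.holds (diaAll^[i] φ) := by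
    intro i
    by_contra! hi
    exact hcon (reflTransGen_iff_iter.2 ⟨i, iter_of_forall_diaAll_iterate hL i hi⟩)
  choose f hf hf' using H
  have : ∀ j, ∃ χ, v.holds χ ∧ ∀ u : World L, u.holds χ → ∀ i < j, u.holds (f i) := by
    intro j
    induction j with
    | zero => exact ⟨imp bot bot, by simp, by simp⟩
    | succ j ih =>
      obtain ⟨χ, h1, h2⟩ := ih
      refine ⟨χ.and (f j), by simpa using ⟨h1, hf j⟩, fun u hu i hi => ?_⟩
      rw [World.holds_and] at hu
      rcases Nat.lt_succ_iff_lt_or_eq.1 hi with hi | rfl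
      · exact h2 u hu.1 i hi
      · exact hu.2
  obtain ⟨χ, h1, h2⟩ := this (n + 1)
  obtain ⟨i, hi, h3⟩ := (w.holds_diaLe_iff n χ).1 (h χ h1)
  rw [World.holds_diaAll_iterate hL] at h3
  obtain ⟨u, h4, h5⟩ := h3
  exact hf' i ((World.holds_diaAll_iterate hL _ _ _).2 ⟨u, h4, h2 u h5 i (by omega)⟩)

end Fintype

/-! ### Variables of formulas -/

lemma isKFormula_disj {A : Type u} {k : ℕ} {l : List (Formula A)}
    (h : ∀ φ ∈ l, IsKFormula k φ) : IsKFormula k (disj l) := by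
  induction l with
  | nil => trivial
  | cons φ l ih =>
    exact ⟨⟨h φ (by simp), trivial⟩, ih fun ψ hψ => h ψ (by simp [hψ])⟩

lemma isKFormula_diaLe {A : Type u} [Fintype A] {k : ℕ} (n : ℕ) {φ : Formula A}
    (hφ : IsKFormula k φ) : IsKFormula k (diaLe n φ) := by
  have : ∀ i, IsKFormula k (diaAll^[i] φ) := by
    intro i
    induction i with
    | zero => exact hφ
    | succ i ih =>
      rw [Function.iterate_succ_apply']
      refine isKFormula_disj fun ψ hψ => ?_
      obtain ⟨a, -, rfl⟩ := List.mem_map.1 hψ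
      exact ih
  refine isKFormula_disj fun ψ hψ => ?_
  obtain ⟨i, -, rfl⟩ := List.mem_map.1 hψ
  exact this i

/-! ### Local tabularity -/

section KFinite

variable {A : Type u} {L : Set (Formula A)} {k : ℕ}

lemma kFinite_of_finite (hL : IsLogic L) {T : Type v} [Finite T] (τ : Formula A → T)
    (h : ∀ φ ψ, IsKFormula k φ → IsKFormula k ψ → τ φ = τ ψ → φ.iff ψ ∈ L) : KFinite L k := by
  let F : T → Set (Formula A) := fun t =>
    {ψ | IsKFormula k ψ ∧ ∃ φ, IsKFormula k φ ∧ τ φ = t ∧ φ.iff ψ ∈ L}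
  refine (Set.finite_range F).subset ?_
  rintro _ ⟨φ, hφ, rfl⟩
  refine ⟨τ φ, Set.ext fun ψ => and_congr_right fun hψ => ⟨?_, fun h' => ⟨φ, hφ, rfl, h'⟩⟩⟩
  rintro ⟨χ, hχ, h1, h2⟩
  have h3 := h χ φ hχ hφ h1
  rw [mem_iff_forall_world hL] at h2 h3 ⊢
  intro w
  have h4 := h2 w
  have h5 := h3 w
  simp only [World.holds_iff] at *
  tauto

/-- A finite system of representatives of the `k`-formulas. -/
lemma KFinite.exists_representatives (hL : IsLogic L) (h : KFinite L k) :
    ∃ (T : Type u) (_ : Finite T) (τ : Formula A → T) (r : T → Formula A),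
      (∀ t, IsKFormula k (r t)) ∧ ∀ φ, IsKFormula k φ → φ.iff (r (τ φ)) ∈ L := by
  classical
  let S := {C : Set (Formula A) | ∃ φ, IsKFormula k φ ∧ C = {ψ | IsKFormula k ψ ∧ iff φ ψ ∈ L}}
  have : Finite S := h
  have hself : ∀ φ : Formula A, φ.iff φ ∈ L := fun φ =>
    (mem_iff_forall_world hL).2 fun w => by simp
  have hS : ∀ C : S, ∃ φ, IsKFormula k φ ∧ φ ∈ C.1 := by
    rintro ⟨_, φ, hφ, rfl⟩
    exact ⟨φ, hφ, hφ, hself φ⟩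
  choose r hr hr' using hS
  let cls : Formula A → Set (Formula A) := fun φ => {ψ | IsKFormula k ψ ∧ iff φ ψ ∈ L}
  refine ⟨S, this, fun φ => if hφ : IsKFormula k φ then ⟨cls φ, φ, hφ, rfl⟩ else
    ⟨cls bot, bot, trivial, rfl⟩, r, hr, fun φ hφ => ?_⟩
  simp only [hφ, dite_true]
  exact (hr' ⟨cls φ, φ, hφ, rfl⟩).2

lemma KFinite.exists_eq (hL : IsLogic L) (h : KFinite L k) {f : ℕ → Formula A}
    (hf : ∀ i, IsKFormula k (f i)) : ∃ i j, i < j ∧ (f i).iff (f j) ∈ L := by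
  obtain ⟨T, _, τ, r, -, hr⟩ := h.exists_representatives hL
  obtain ⟨i, j, hne, hij⟩ := Finite.exists_ne_map_eq_of_infinite fun i => τ (f i)
  have key : ∀ i j, τ (f i) = τ (f j) → (f i).iff (f j) ∈ L := by
    intro i j hij
    have h1 := hr _ (hf i)
    have h2 := hr _ (hf j)
    rw [mem_iff_forall_world hL] at h1 h2 ⊢
    intro w
    have h4 := h1 w
    have h5 := h2 w
    simp only [World.holds_iff, hij] at *
    tauto
  rcases lt_or_gt_of_ne hne with h | h
  · exact ⟨i, j, h, key i j hij⟩
  · exact ⟨j, i, h, key j i hij.symm⟩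

end KFinite

/-! ### Change of alphabet -/

section Pull

variable {A : Type u} {B : Type v}

/-- The formulas over `A` that belong to `M` after the renaming `f : A → B` of modalities. -/
def pull (f : A → B) (M : Set (Formula B)) : Set (Formula A) := {φ | φ.map f ∈ M}

lemma map_map {C : Type*} (f : A → B) (g : B → C) (φ : Formula A) :
    (φ.map f).map g = φ.map (g ∘ f) := by
  induction φ <;> simp_all [Formula.map]

lemma map_id (φ : Formula A) : φ.map id = φ := by
  induction φ <;> simp_all [Formula.map]

lemma map_subst (f : A → B) (σ : ℕ → Formula A) (φ : Formula A) :
    (φ.subst σ).map f = (φ.map f).subst (fun n => (σ n).map f) := by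
  induction φ <;> simp_all [Formula.map, subst]

lemma isKFormula_map (f : A → B) {k : ℕ} (φ : Formula A) :
    IsKFormula k (φ.map f) ↔ IsKFormula k φ := by
  induction φ <;> simp_all [Formula.map, IsKFormula]

lemma map_disj (f : A → B) (l : List (Formula A)) :
    (disj l).map f = disj (l.map (Formula.map f)) := by
  induction l with
  | nil => rfl
  | cons φ l ih =>
    simp only [disj, List.foldr_cons, List.map_cons] at ih ⊢
    rw [← ih]; rfl

lemma isLogic_pull (f : A → B) {M : Set (Formula B)} (hM : IsLogic M) : IsLogic (pull f M) where
  taut φ hφ := hM.taut _ fun t hb hi =>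
    hφ (fun ψ => t (ψ.map f)) hb fun ψ χ => hi (ψ.map f) (χ.map f)
  dia_bot a := hM.dia_bot (f a)
  dia_or a := hM.dia_or (f a)
  mp φ ψ h h' := hM.mp _ _ h h'
  subst σ φ h := by
    have := hM.subst (fun n => (σ n).map f) _ h
    rwa [← map_subst] at this
  mono a φ ψ h := hM.mono (f a) _ _ h

lemma isLogic_restrict {M : Set (Formula A)} (hM : IsLogic M) (s : Finset A) :
    IsLogic (restrict M s) := isLogic_pull _ hM

lemma LocallyTabular.pull {M : Set (Formula B)} (hM : IsLogic M) (h : LocallyTabular M)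
    (f : A → B) : LocallyTabular (pull f M) := by
  intro k
  obtain ⟨T, _, τ, r, -, hr⟩ := (h k).exists_representatives hM
  refine kFinite_of_finite (isLogic_pull f hM) (fun φ => τ (φ.map f)) fun φ ψ hφ hψ hφψ => ?_
  have h1 := hr _ ((isKFormula_map f φ).2 hφ)
  have h2 := hr _ ((isKFormula_map f ψ).2 hψ)
  change (φ.map f).iff (ψ.map f) ∈ M
  rw [mem_iff_forall_world hM] at h1 h2 ⊢
  intro w
  have h4 := h1 w
  have h5 := h2 w
  simp only [World.holds_iff, hφψ] at *
  tauto

lemma LocallyTabular.restrict {M : Set (Formula A)} (hM : IsLogic M) (h : LocallyTabular M)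
    (s : Finset A) : LocallyTabular (restrict M s) := h.pull hM _

end Pull

/-! ### Finite height -/

section FiniteHeight

variable {A : Type u} [Fintype A] {L : Set (Formula A)}

/-- The formula of height `h` written with the modality `◇_A^{≤ n}`. -/
noncomputable abbrev heightForm (A : Type u) [Fintype A] (n h : ℕ) : Formula A :=
  starForm n (heightFormula h)

lemma heightForm_succ (n h : ℕ) : heightForm A n (h + 1) =
    imp (var (h + 1)) (neg (diaLe n (neg ((diaLe n (var (h + 1))).or (heightForm A n h))))) := rfl

lemma World.diaLe_congr (hL : IsLogic L) {m n : ℕ} (hm : tr A m ∈ L) (hn : tr A n ∈ L)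
    {φ ψ : Formula A} (h : ∀ v : World L, v.holds φ ↔ v.holds ψ) (w : World L) :
    w.holds (diaLe m φ) ↔ w.holds (diaLe n ψ) := by
  simp only [World.holds_diaLe_of_tr hL hm, World.holds_diaLe_of_tr hL hn, h]

lemma World.starForm_congr (hL : IsLogic L) {m n : ℕ} (hm : tr A m ∈ L) (hn : tr A n ∈ L)
    (φ : Formula Unit) (w : World L) : w.holds (starForm m φ) ↔ w.holds (starForm n φ) := by
  induction φ generalizing w with
  | var => rfl
  | bot => rfl
  | imp φ ψ h1 h2 => simp only [starForm, World.holds_imp, h1, h2]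
  | dia a φ h => exact World.diaLe_congr hL hm hn h w

lemma transIndex_lt_top_iff : transIndex L < ⊤ ↔ ∃ n, tr A n ∈ L := by
  constructor
  · intro h
    by_contra! hn
    have : {x : ℕ∞ | ∃ m : ℕ, tr A m ∈ L ∧ x = m} = ∅ :=
      Set.eq_empty_of_forall_notMem fun x ⟨m, hm, _⟩ => hn m hm
    simp [transIndex, this] at h
  · rintro ⟨n, hn⟩
    have : transIndex L ≤ n := sInf_le ⟨n, hn, rfl⟩
    exact this.trans_lt (ENat.natCast_lt_top n)

lemma tr_toNat_transIndex (h : transIndex L < ⊤) : tr A (transIndex L).toNat ∈ L := by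
  obtain ⟨n, hn⟩ := transIndex_lt_top_iff.1 h
  obtain ⟨m, hm, h'⟩ := csInf_mem (s := {x : ℕ∞ | ∃ m : ℕ, tr A m ∈ L ∧ x = m}) ⟨n, n, hn, rfl⟩
  have : transIndex L = m := h'
  rwa [this, ENat.toNat_natCast]

/-- `L` is pretransitive and of finite height. -/
def HasFiniteHeight (L : Set (Formula A)) : Prop := ∃ n h, tr A n ∈ L ∧ heightForm A n h ∈ L

lemma height_lt_top_iff (hL : IsLogic L) : height L < ⊤ ↔ HasFiniteHeight L := by
  by_cases hT : transIndex L = ⊤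
  · have h1 : ¬ ∃ n, tr A n ∈ L := by
      rw [← transIndex_lt_top_iff, hT]; simp
    simp only [height, hT, if_true, lt_irrefl, false_iff]
    rintro ⟨n, -, h2, -⟩
    exact h1 ⟨n, h2⟩
  · have h0 := tr_toNat_transIndex (lt_top_iff_ne_top.2 hT)
    rw [height, if_neg hT]
    constructor
    · intro h
      by_contra hn
      have : {x : ℕ∞ | ∃ h : ℕ, starForm (transIndex L).toNat (heightFormula h) ∈ L ∧ x = h} = ∅ :=
        Set.eq_empty_of_forall_notMem fun x ⟨m, hm, _⟩ => hn ⟨_, m, h0, hm⟩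
      simp [this] at h
    · rintro ⟨n, h, h1, h2⟩
      have h3 : starForm (transIndex L).toNat (heightFormula h) ∈ L := by
        rw [mem_iff_forall_world hL] at h2 ⊢
        exact fun w => (World.starForm_congr hL h0 h1 _ w).2 (h2 w)
      have h4 : sInf {x : ℕ∞ | ∃ h : ℕ, starForm (transIndex L).toNat (heightFormula h) ∈ L ∧ x = h}
          ≤ h := sInf_le ⟨h, h3, rfl⟩
      exact h4.trans_lt (ENat.natCast_lt_top h)

/-! ### Finite height under surjective renaming of modalities. -/

section Surjective

variable {B : Type v} [Fintype B] {M : Set (Formula B)} {f : A → B}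

lemma World.holds_map_diaAll (hM : IsLogic M) (hf : f.Surjective) {φ : Formula A} {ψ : Formula B}
    (h : ∀ v : World M, v.holds (φ.map f) ↔ v.holds ψ) (w : World M) :
    w.holds ((diaAll φ).map f) ↔ w.holds (diaAll ψ) := by
  have : w.holds ((diaAll φ).map f) ↔ ∃ a, w.holds (dia (f a) (φ.map f)) := by
    simp [diaAll, map_disj, Formula.map]
  simp only [this, World.holds_diaAll_iff, hf.exists, World.holds_dia hM, h]

lemma World.holds_map_diaAll_iterate (hM : IsLogic M) (hf : f.Surjective) {φ : Formula A}
    {ψ : Formula B} (h : ∀ v : World M, v.holds (φ.map f) ↔ v.holds ψ) (n : ℕ) (w : World M) :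
    w.holds ((diaAll^[n] φ).map f) ↔ w.holds (diaAll^[n] ψ) := by
  induction n generalizing w with
  | zero => exact h w
  | succ n ih =>
    simp only [Function.iterate_succ_apply']
    exact World.holds_map_diaAll hM hf ih w

lemma World.holds_map_diaLe (hM : IsLogic M) (hf : f.Surjective) {φ : Formula A}
    {ψ : Formula B} (h : ∀ v : World M, v.holds (φ.map f) ↔ v.holds ψ) (n : ℕ) (w : World M) :
    w.holds ((diaLe n φ).map f) ↔ w.holds (diaLe n ψ) := by
  have : w.holds ((diaLe n φ).map f) ↔ ∃ i < n + 1, w.holds ((diaAll^[i] φ).map f) := by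
    simp only [diaLe, map_disj, World.holds_disj, List.mem_map, List.mem_range]
    exact ⟨fun ⟨_, ⟨_, ⟨i, hi, rfl⟩, h⟩, h'⟩ => ⟨i, hi, h ▸ h'⟩,
      fun ⟨i, hi, h⟩ => ⟨_, ⟨_, ⟨i, hi, rfl⟩, rfl⟩, h⟩⟩
  simp only [this, World.holds_diaLe_iff, World.holds_map_diaAll_iterate hM hf h, Nat.lt_succ_iff]

lemma World.holds_map_starForm (hM : IsLogic M) (hf : f.Surjective) (n : ℕ) (φ : Formula Unit)
    (w : World M) : w.holds ((starForm n φ : Formula A).map f) ↔ w.holds (starForm n φ) := by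
  induction φ generalizing w with
  | var => rfl
  | bot => rfl
  | imp φ ψ h1 h2 => simp only [starForm, Formula.map, World.holds_imp, h1, h2]
  | dia a φ h => exact World.holds_map_diaLe hM hf h n w

/-- Height depends only on the joint modality, and a surjection of alphabets identifies the two
disjunctions. This serves to replace an alphabet by a copy of it. -/
lemma HasFiniteHeight.of_pull (hM : IsLogic M) (hf : f.Surjective)
    (h : HasFiniteHeight (pull f M)) : HasFiniteHeight M := by
  obtain ⟨n, h, h1, h2⟩ := h
  refine ⟨n, h, ?_, ?_⟩
  · change (tr A n).map f ∈ M at h1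
    rw [mem_iff_forall_world hM] at h1 ⊢
    intro w
    have := h1 w
    rw [tr, Formula.map, World.holds_imp, World.holds_map_diaAll_iterate hM hf (ψ := var 0),
      World.holds_map_diaLe hM hf (ψ := var 0)] at this
    · simpa [tr] using this
    · exact fun _ => Iff.rfl
    · exact fun _ => Iff.rfl
  · change (heightForm A n h).map f ∈ M at h2
    rw [mem_iff_forall_world hM] at h2 ⊢
    exact fun w => (World.holds_map_starForm hM hf _ _ w).1 (h2 w)

end Surjective

/-! ### Locally tabular logics have finite height -/

/-- By pigeonhole `◇^{≤ i} p` and `◇^{≤ j} p` are equivalent for some `i < j`, and `◇^{i+1} p`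
implies the latter. -/
lemma LocallyTabular.exists_tr (hL : IsLogic L) (h : LocallyTabular L) : ∃ n, tr A n ∈ L := by
  obtain ⟨i, j, hij, h1⟩ := (h 1).exists_eq hL (f := fun i => diaLe i (var 0)) fun i =>
    isKFormula_diaLe i (by simp [IsKFormula])
  refine ⟨i, ?_⟩
  rw [mem_iff_forall_world hL] at h1 ⊢
  intro w
  have h2 := h1 w
  rw [World.holds_iff] at h2
  rw [tr, World.holds_imp, h2, World.holds_diaLe_iff]
  exact fun h3 => ⟨i + 1, hij, h3⟩

/-- The formula stating that `q` and `¬ q` alternate `i` times on a chain. -/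
noncomputable def altFormula (n : ℕ) (q : Formula A) : ℕ → Formula A
  | 0 => imp bot bot
  | i + 1 => diaLe n (q.and (diaLe n (q.neg.and (altFormula n q i))))

lemma subst_altFormula (n : ℕ) (q : Formula A) (σ : ℕ → Formula A) (i : ℕ) :
    (altFormula n q i).subst σ = altFormula n (q.subst σ) i := by
  induction i with
  | zero => rfl
  | succ i ih =>
    simp only [altFormula, subst_diaLe, Formula.and, subst, neg, ih]

/-- The formula stating that the level of a point, i.e. the greatest `l ≤ h` such that `p_l` is
satisfied at a reachable point, is odd. -/
noncomputable def oddLevel (A : Type u) [Fintype A] (n : ℕ) : ℕ → Formula A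
  | 0 => bot
  | h + 1 => if Odd (h + 1) then (diaLe n (var (h + 1))).or (oddLevel A n h)
      else (diaLe n (var (h + 1))).neg.and (oddLevel A n h)

open Classical in
/-- The greatest `l ≤ h` such that `p_l` is satisfied at a point reachable from `w`. -/
noncomputable def World.level (n : ℕ) (w : World L) : ℕ → ℕ
  | 0 => 0
  | h + 1 => if w.holds (diaLe n (var (h + 1))) then h + 1 else World.level n w h

lemma World.holds_oddLevel (n h : ℕ) (w : World L) :
    w.holds (oddLevel A n h) ↔ Odd (w.level n h) := by
  induction h with
  | zero => simp [oddLevel, level]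
  | succ h ih =>
    by_cases h1 : Odd (h + 1) <;> by_cases h2 : w.holds (diaLe n (var (h + 1))) <;>
      simp [oddLevel, level, h1, h2, ih]

lemma World.level_le (n h : ℕ) (w : World L) : w.level n h ≤ h := by
  induction h with
  | zero => simp [level]
  | succ h ih =>
    rw [level]
    split_ifs
    · rfl
    · omega

lemma World.level_anti (hL : IsLogic L) {n : ℕ} (hn : tr A n ∈ L) (h : ℕ) {w v : World L}
    (hwv : Reach w v) : v.level n h ≤ w.level n h := by
  induction h with
  | zero => simp [level]
  | succ h ih =>
    rw [level, level]
    split_ifs with h1 h2 h2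
    · rfl
    · rw [World.holds_diaLe_of_tr hL hn] at h1 h2
      obtain ⟨u, h3, h4⟩ := h1
      exact (h2 ⟨u, hwv.trans h3, h4⟩).elim
    · exact (v.level_le n h).trans (by omega)
    · exact ih

lemma World.level_eq {n j h : ℕ} {w : World L} (hjh : j ≤ h)
    (hj : j = 0 ∨ w.holds (diaLe n (var j)))
    (hw : ∀ l, j < l → l ≤ h → ¬ w.holds (diaLe n (var l))) : w.level n h = j := by
  induction h with
  | zero => simp [level]; omega
  | succ h ih =>
    rw [level]
    rcases hjh.lt_or_eq with h1 | rfl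
    · rw [if_neg (hw _ h1 le_rfl), ih (by omega) fun l h2 h3 => hw l h2 (by omega)]
    · rw [if_pos (hj.resolve_left (by omega))]

lemma World.holds_altFormula_succ (hL : IsLogic L) {n : ℕ} (hn : tr A n ∈ L) (q : Formula A)
    (i : ℕ) (w : World L) : w.holds (altFormula n q (i + 1)) ↔
      ∃ u, Reach w u ∧ u.holds q ∧ ∃ v, Reach u v ∧ ¬ v.holds q ∧ v.holds (altFormula n q i) := by
  simp only [altFormula, World.holds_diaLe_of_tr hL hn, World.holds_and, World.holds_neg]

lemma World.holds_altFormula_anti (hL : IsLogic L) {n : ℕ} (hn : tr A n ∈ L) (q : Formula A)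
    {i j : ℕ} (hij : i ≤ j) (w : World L) (h : w.holds (altFormula n q j)) :
    w.holds (altFormula n q i) := by
  induction i generalizing j w with
  | zero => simp [altFormula]
  | succ i ih =>
    obtain ⟨j, rfl⟩ := Nat.exists_eq_add_of_le' (show 1 ≤ j by omega)
    rw [World.holds_altFormula_succ hL hn] at h ⊢
    obtain ⟨u, h1, h2, v, h3, h4, h5⟩ := h
    exact ⟨u, h1, h2, v, h3, h4, ih (by omega) v h5⟩

/-- Levels never increase along reachability, so each change of parity costs at least one, and a
full alternation starting at an even level costs two. -/
lemma World.le_level_of_holds_altFormula (hL : IsLogic L) {n : ℕ} (hn : tr A n ∈ L) (h i : ℕ)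
    (w : World L) (hw : w.holds (altFormula n (oddLevel A n h) i)) (he : ¬ Odd (w.level n h)) :
    2 * i ≤ w.level n h := by
  induction i generalizing w with
  | zero => simp
  | succ i ih =>
    rw [World.holds_altFormula_succ hL hn] at hw
    obtain ⟨u, h1, h2, v, h3, h4, h5⟩ := hw
    rw [World.holds_oddLevel] at h2 h4
    have h6 := ih v h5 h4
    have h7 := World.level_anti hL hn h h1
    have h8 := World.level_anti hL hn h h3
    rw [Nat.not_odd_iff_even] at he h4
    rcases he with ⟨a, ha⟩
    rcases h4 with ⟨b, hb⟩
    rcases h2 with ⟨c, hc⟩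
    omega

lemma World.exists_of_not_heightForm (hL : IsLogic L) {n h : ℕ} (hn : tr A n ∈ L) {w : World L}
    (hw : ¬ w.holds (heightForm A n (h + 1))) : w.holds (diaLe n (var (h + 1))) ∧
      ∃ v, Reach w v ∧ ¬ v.holds (diaLe n (var (h + 1))) ∧ ¬ v.holds (heightForm A n h) := by
  rw [heightForm_succ] at hw
  simp only [World.holds_imp, World.holds_neg, not_forall, not_not] at hw
  obtain ⟨h1, h2⟩ := hw
  rw [World.holds_diaLe_of_tr hL hn] at h2
  obtain ⟨v, h3, h4⟩ := h2
  rw [World.holds_neg, World.holds_or, not_or] at h4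
  exact ⟨(World.holds_diaLe_of_tr hL hn _ _).2 ⟨w, .refl, h1⟩, v, h3, h4⟩

lemma World.not_diaLe_of_reach (hL : IsLogic L) {n : ℕ} (hn : tr A n ∈ L) {w v : World L}
    (h : Reach w v) {φ : Formula A} (hw : ¬ w.holds (diaLe n φ)) : ¬ v.holds (diaLe n φ) := by
  rw [World.holds_diaLe_of_tr hL hn] at hw ⊢
  rintro ⟨u, h1, h2⟩
  exact hw ⟨u, h.trans h1, h2⟩

lemma World.level_of_not_heightForm (hL : IsLogic L) {n h : ℕ} (hn : tr A n ∈ L) {j : ℕ}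
    (hjh : j ≤ h) {w : World L} (hw : ¬ w.holds (heightForm A n j))
    (hl : ∀ l, j < l → l ≤ h → ¬ w.holds (diaLe n (var l))) : w.level n h = j := by
  refine World.level_eq hjh ?_ hl
  cases j with
  | zero => exact .inl rfl
  | succ j => exact .inr (World.exists_of_not_heightForm hL hn hw).1

/-- Unfolding the failure of `B_{2i}` gives a chain along which `p_{2i}, p_{2i-1}, …` successively
cease to be reachable. The level drops by exactly one each time, so its parity alternates. -/
lemma World.holds_altFormula_of_not_heightForm (hL : IsLogic L) {n h : ℕ} (hn : tr A n ∈ L)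
    (i : ℕ) (hi : 2 * i ≤ h) (w : World L) (hw : ¬ w.holds (heightForm A n (2 * i)))
    (hl : ∀ l, 2 * i < l → l ≤ h → ¬ w.holds (diaLe n (var l))) :
    w.holds (altFormula n (oddLevel A n h) i) := by
  induction i generalizing w with
  | zero => simp [altFormula]
  | succ i ih =>
    obtain ⟨-, u, hwu, hu1, hu2⟩ := World.exists_of_not_heightForm hL hn (h := 2 * i + 1) hw
    obtain ⟨-, v, huv, hv1, hv2⟩ := World.exists_of_not_heightForm hL hn hu2
    have hlu : ∀ l, 2 * i + 1 < l → l ≤ h → ¬ u.holds (diaLe n (var l)) := by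
      intro l h1 h2
      rcases (show l = 2 * i + 1 + 1 ∨ 2 * (i + 1) < l by omega) with rfl | h3
      · exact hu1
      · exact World.not_diaLe_of_reach hL hn hwu (hl l h3 h2)
    have hlv : ∀ l, 2 * i < l → l ≤ h → ¬ v.holds (diaLe n (var l)) := by
      intro l h1 h2
      rcases (show l = 2 * i + 1 ∨ 2 * i + 1 < l by omega) with rfl | h3
      · exact hv1
      · exact World.not_diaLe_of_reach hL hn huv (hlu l h3 h2)
    rw [World.holds_altFormula_succ hL hn]
    refine ⟨u, hwu, ?_, v, huv, ?_, ih (by omega) v hv2 hlv⟩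
    · rw [World.holds_oddLevel, World.level_of_not_heightForm hL hn (by omega) hu2 hlu]
      exact ⟨i, rfl⟩
    · rw [World.holds_oddLevel, World.level_of_not_heightForm hL hn (by omega) hv2 hlv]
      simp

lemma isKFormula_altFormula {k : ℕ} (n : ℕ) {q : Formula A} (hq : IsKFormula k q) (i : ℕ) :
    IsKFormula k (altFormula n q i) := by
  induction i with
  | zero => simp [altFormula, IsKFormula]
  | succ i ih =>
    exact isKFormula_diaLe n ⟨⟨hq, isKFormula_diaLe n ⟨⟨⟨hq, trivial⟩, ih, trivial⟩, trivial⟩,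
      trivial⟩, trivial⟩

/-- One-variable formulas suffice: the many variables of `B_{2i}` are coded in the single formula
`oddLevel`. By pigeonhole `i` alternations imply `i + 1`; but where `B_{2i}` fails the level is
`2i`, which allows `i` alternations and no more. -/
theorem LocallyTabular.hasFiniteHeight (hL : IsLogic L) (h : LocallyTabular L) :
    HasFiniteHeight L := by
  obtain ⟨n, hn⟩ := h.exists_tr hL
  obtain ⟨i, j, hij, h1⟩ := (h 1).exists_eq hL (f := altFormula n (var 0))
    fun i => isKFormula_altFormula n (by simp [IsKFormula]) i
  have h2 : imp (altFormula n (var 0) i) (altFormula n (var 0) (i + 1)) ∈ L := by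
    rw [mem_iff_forall_world hL] at h1 ⊢
    intro w
    have := h1 w
    rw [World.holds_iff] at this
    rw [World.holds_imp, this]
    exact World.holds_altFormula_anti hL hn _ hij w
  refine ⟨n, 2 * i, hn, (mem_iff_forall_world hL).2 fun w => ?_⟩
  by_contra hw
  have h3 := World.holds_altFormula_of_not_heightForm hL hn (h := 2 * i) i le_rfl w hw
    (fun l h1 h2 => by omega)
  have h4 := World.level_of_not_heightForm hL hn (h := 2 * i) le_rfl hw (fun l h1 h2 => by omega)
  have h5 := w.of_mem _ (hL.subst (fun _ => oddLevel A n (2 * i)) _ h2)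
  rw [subst, subst_altFormula, subst_altFormula, World.holds_imp] at h5
  have h6 := World.le_level_of_holds_altFormula hL hn _ _ w (h5 h3) (by rw [h4]; simp)
  omega

end FiniteHeight

theorem LocallyTabular.height_restrict_lt_top {A : Type u} {L : Set (Formula A)}
    (hL : IsLogic L) (h : LocallyTabular L)
    (s : Finset A) : height (ModalFH.restrict L s) < ⊤ :=
  (height_lt_top_iff (isLogic_restrict hL s)).2
    ((h.restrict hL s).hasFiniteHeight (isLogic_restrict hL s))

/-! ### Smallest logics -/

section Smallest

variable {A : Type u}

lemma isLogic_smallestLogic (Φ : Set (Formula A)) : IsLogic (smallestLogic Φ) where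
  taut φ hφ := fun _ hL => hL.1.taut φ hφ
  dia_bot a := fun _ hL => hL.1.dia_bot a
  dia_or a := fun _ hL => hL.1.dia_or a
  mp φ ψ h h' := fun L hL => hL.1.mp φ ψ (h L hL) (h' L hL)
  subst σ φ h := fun L hL => hL.1.subst σ φ (h L hL)
  mono a φ ψ h := fun L hL => hL.1.mono a φ ψ (h L hL)

lemma subset_smallestLogic (Φ : Set (Formula A)) : Φ ⊆ smallestLogic Φ :=
  fun _ hφ _ hL => hL.2 hφ

lemma smallestLogic_subset {Φ L : Set (Formula A)} (hL : IsLogic L) (h : Φ ⊆ L) :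
    smallestLogic Φ ⊆ L := fun _ hφ => hφ L ⟨hL, h⟩

lemma isLogic_diff (L : Set (Formula A)) : IsLogic (diff L) := isLogic_smallestLogic _

lemma diff_subset_iff {L : Set (Formula A)} {M : Set (Formula (Option A))} (hM : IsLogic M) :
    diff L ⊆ M ↔ L ⊆ pull some M ∧ ∀ φ, DiffAxiom A φ → φ ∈ M := by
  constructor
  · intro h
    exact ⟨fun φ hφ => h (subset_smallestLogic _ (.inl ⟨φ, hφ, rfl⟩)),
      fun φ hφ => h (subset_smallestLogic _ (.inr hφ))⟩
  · rintro ⟨h1, h2⟩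
    refine smallestLogic_subset hM ?_
    rintro _ (⟨φ, hφ, rfl⟩ | hφ)
    · exact h1 hφ
    · exact h2 _ hφ

end Smallest

/-! ### Conservativity of the expansion with the difference modality -/

section Conservative

variable {A : Type u}

open Classical in
/-- Evaluation in the Lindenbaum algebra of `N`, where the difference modality is read as the
universal modality. -/
noncomputable def evalUniv (N : Set (Formula A)) (σ : ℕ → Formula A) :
    Formula (Option A) → Formula A
  | var n => σ n
  | bot => bot
  | imp φ ψ => imp (evalUniv N σ φ) (evalUniv N σ ψ)
  | dia (some a) φ => dia a (evalUniv N σ φ)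
  | dia none φ => if neg (evalUniv N σ φ) ∈ N then bot else imp bot bot

lemma evalUniv_map (N : Set (Formula A)) (σ : ℕ → Formula A) (φ : Formula A) :
    evalUniv N σ (φ.map some) = φ.subst σ := by
  induction φ <;> simp_all [Formula.map, subst, evalUniv]

lemma evalUniv_subst (N : Set (Formula A)) (σ : ℕ → Formula A) (ρ : ℕ → Formula (Option A))
    (φ : Formula (Option A)) :
    evalUniv N σ (φ.subst ρ) = evalUniv N (fun n => evalUniv N σ (ρ n)) φ := by
  induction φ with
  | var n => rfl
  | bot => rfl
  | imp φ ψ h1 h2 => simp only [subst, evalUniv, h1, h2]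
  | dia a φ h =>
    cases a with
    | none => simp only [subst, evalUniv]; rw [h]
    | some a => simp only [subst, evalUniv, h]

lemma subst_var (φ : Formula A) : φ.subst var = φ := by
  induction φ <;> simp_all [subst]

/-- The formulas valid in the Lindenbaum algebra of `N` with the universal modality. -/
def univLogic (N : Set (Formula A)) : Set (Formula (Option A)) := {φ | ∀ σ, evalUniv N σ φ ∈ N}

lemma evalUniv_none_of_mem {N : Set (Formula A)} {σ : ℕ → Formula A} {φ : Formula (Option A)}
    (h : neg (evalUniv N σ φ) ∈ N) : evalUniv N σ (dia none φ) = bot := if_pos h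

lemma evalUniv_none_of_notMem {N : Set (Formula A)} {σ : ℕ → Formula A} {φ : Formula (Option A)}
    (h : neg (evalUniv N σ φ) ∉ N) : evalUniv N σ (dia none φ) = imp bot bot := if_neg h

lemma isLogic_univLogic {N : Set (Formula A)} (hN : IsLogic N) : IsLogic (univLogic N) where
  taut φ hφ := fun σ => hN.taut _ fun t hb hi =>
    hφ (fun ψ => t (evalUniv N σ ψ)) hb fun ψ χ => hi _ _
  dia_bot a := by
    intro σ
    cases a with
    | some a => exact hN.dia_bot a
    | none =>
      have h : neg (evalUniv N σ bot) ∈ N :=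
        (mem_iff_forall_world hN).2 fun w => by simp [evalUniv]
      change imp (evalUniv N σ (dia none bot)) bot ∈ N
      rw [evalUniv_none_of_mem h]
      exact h
  dia_or a := by
    intro σ
    cases a with
    | some a =>
      have h := hN.subst σ _ (hN.dia_or a)
      have h' := evalUniv_map N σ (imp (dia a ((var 0).or (var 1)))
        ((dia a (var 0)).or (dia a (var 1))))
      rw [← h'] at h
      exact h
    | none =>
      change imp (evalUniv N σ (dia none ((var 0).or (var 1))))
        ((evalUniv N σ (dia none (var 0))).or (evalUniv N σ (dia none (var 1)))) ∈ N
      by_cases h0 : neg (evalUniv N σ (var 0)) ∈ N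
      · by_cases h1 : neg (evalUniv N σ (var 1)) ∈ N
        · rw [evalUniv_none_of_mem (φ := (var 0).or (var 1))]
          · exact (mem_iff_forall_world hN).2 fun w => by simp
          · rw [mem_iff_forall_world hN] at h0 h1 ⊢
            intro w
            have := h0 w
            have := h1 w
            change w.holds (neg ((evalUniv N σ (var 0)).or (evalUniv N σ (var 1))))
            simp_all
        · rw [evalUniv_none_of_notMem h1]
          exact (mem_iff_forall_world hN).2 fun w => by simp
      · rw [evalUniv_none_of_notMem h0]
        exact (mem_iff_forall_world hN).2 fun w => by simp
  mp φ ψ h h' := fun σ => hN.mp _ _ (h σ) (h' σ)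
  subst ρ φ h := fun σ => by
    rw [evalUniv_subst]
    exact h _
  mono a φ ψ h := by
    intro σ
    cases a with
    | some a => exact hN.mono a _ _ (h σ)
    | none =>
      change imp (evalUniv N σ (dia none φ)) (evalUniv N σ (dia none ψ)) ∈ N
      by_cases h1 : neg (evalUniv N σ ψ) ∈ N
      · rw [evalUniv_none_of_mem (φ := φ)]
        · exact (mem_iff_forall_world hN).2 fun w => by simp
        · have h2 : imp (evalUniv N σ φ) (evalUniv N σ ψ) ∈ N := h σ
          rw [mem_iff_forall_world hN] at h1 h2 ⊢
          intro w
          have := h1 w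
          have := h2 w
          simp_all
      · rw [evalUniv_none_of_notMem h1]
        exact (mem_iff_forall_world hN).2 fun w => by simp

lemma diffAxiom_mem_univLogic {N : Set (Formula A)} (hN : IsLogic N) {φ : Formula (Option A)}
    (hφ : DiffAxiom A φ) : φ ∈ univLogic N := by
  intro σ
  cases hφ with
  | symm =>
    change imp (σ 0) (neg (evalUniv N σ (dia none (dia none (var 0)).neg))) ∈ N
    rw [mem_iff_forall_world hN]
    intro w
    by_cases h0 : neg (evalUniv N σ (var 0)) ∈ N
    · have := w.of_mem _ h0
      simp_all [evalUniv]
    · rw [evalUniv_none_of_mem]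
      · simp
      · change neg (neg (evalUniv N σ (dia none (var 0)))) ∈ N
        rw [evalUniv_none_of_notMem h0, mem_iff_forall_world hN]
        simp
  | trans =>
    change imp (evalUniv N σ (dia none (dia none (var 0))))
      ((evalUniv N σ (dia none (var 0))).or (σ 0)) ∈ N
    rw [mem_iff_forall_world hN]
    intro w
    by_cases h0 : neg (evalUniv N σ (var 0)) ∈ N
    · rw [evalUniv_none_of_mem (φ := dia none (var 0))]
      · simp
      · rw [evalUniv_none_of_mem h0, mem_iff_forall_world hN]
        simp
    · rw [evalUniv_none_of_notMem h0]
      simp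
  | incl a =>
    change imp (dia a (σ 0)) ((evalUniv N σ (dia none (var 0))).or (σ 0)) ∈ N
    rw [mem_iff_forall_world hN]
    intro w
    by_cases h0 : neg (evalUniv N σ (var 0)) ∈ N
    · have h1 : ¬ w.holds (dia a (σ 0)) := World.not_dia_of_forall hN fun v => by
        have := v.of_mem _ h0
        simpa [evalUniv] using this
      simp [h1]
    · rw [evalUniv_none_of_notMem h0]
      simp

/-- The Lindenbaum algebra of `N` with the universal modality validates `diff N`, and at the
identity valuation a formula over `A` evaluates to itself. Being algebraic, the argument does not
need `N` to be Kripke complete. -/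
lemma pull_diff {N : Set (Formula A)} (hN : IsLogic N) : pull some (diff N) = N := by
  refine Set.Subset.antisymm (fun φ hφ => ?_) ((diff_subset_iff (isLogic_diff N)).1 subset_rfl).1
  have h : diff N ⊆ univLogic N := (diff_subset_iff (isLogic_univLogic hN)).2
    ⟨fun φ hφ σ => by rw [evalUniv_map]; exact hN.subst σ φ hφ,
      fun φ hφ => diffAxiom_mem_univLogic hN hφ⟩
  have h1 := h hφ var
  rwa [evalUniv_map, subst_var] at h1

end Conservative

/-! ### Canonical frames with the difference modality -/

section Difference

variable {A : Type u} {M : Set (Formula (Option A))}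

/-- Frames of the logic of the difference modality `d`, in which the relations of the other
modalities are included in the union of `R_d` and the identity. -/
structure IsDifference {A : Type u} (L : Set (Formula A)) (d : A) : Prop where
  symm : ∀ {w v : World L}, World.Rel d w v → World.Rel d v w
  trans : ∀ {w v u : World L}, World.Rel d w v → World.Rel d v u → World.Rel d w u ∨ w = u
  incl : ∀ {a} {w v : World L}, World.Rel a w v → World.Rel d w v ∨ w = v

lemma World.eq_of_le {A : Type u} {L : Set (Formula A)} {w v : World L}
    (h : ∀ φ, v.holds φ → w.holds φ) : w = v := by
  refine World.ext (funext fun φ => propext ⟨fun hw => ?_, h φ⟩)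
  by_contra hv
  exact (w.holds_neg φ).1 (h φ.neg ((v.holds_neg φ).2 hv)) hw

/-- This makes axioms with conclusion `◇p ∨ p` canonical: a formula refuting `R_d w v` and one
refuting `w = v` are combined in a conjunction that refutes both disjuncts. -/
lemma World.rel_or_eq {A : Type u} {L : Set (Formula A)} (hL : IsLogic L) {d : A} {w v : World L}
    (h : ∀ φ, v.holds φ → w.holds (dia d φ) ∨ w.holds φ) : World.Rel d w v ∨ w = v := by
  by_contra! hcon
  obtain ⟨h1, h2⟩ := hcon
  have h3 : ∃ φ, v.holds φ ∧ ¬ w.holds (dia d φ) := by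
    by_contra! h'
    exact h1 h'
  have h4 : ∃ φ, v.holds φ ∧ ¬ w.holds φ := by
    by_contra! h'
    exact h2 (World.eq_of_le h')
  obtain ⟨φ, h5, h6⟩ := h3
  obtain ⟨ψ, h7, h8⟩ := h4
  rcases h (φ.and ψ) (by simp [h5, h7]) with h | h
  · exact h6 (World.dia_mono hL (by simp +contextual) h)
  · exact h8 (by simp at h; exact h.2)

lemma isDifference_of_axioms {A : Type u} {L : Set (Formula A)} (hL : IsLogic L) {d : A}
    (symm : imp (var 0) (box d (dia d (var 0))) ∈ L)
    (trans : imp (dia d (dia d (var 0))) ((dia d (var 0)).or (var 0)) ∈ L)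
    (incl : ∀ a, imp (dia a (var 0)) ((dia d (var 0)).or (var 0)) ∈ L) : IsDifference L d where
  symm {w v} h φ hφ := by
    have h1 := w.of_mem _ (hL.subst (fun _ => φ) _ symm)
    by_contra h2
    have h3 := (w.holds_imp φ (neg (dia d (neg (dia d φ))))).1 h1 hφ
    rw [World.holds_neg] at h3
    exact h3 (h _ ((v.holds_neg _).2 h2))
  trans {w v u} h h' := World.rel_or_eq hL fun φ hφ => by
    have h1 := w.of_mem _ (hL.subst (fun _ => φ) _ trans)
    have h2 := (w.holds_imp (dia d (dia d φ)) ((dia d φ).or φ)).1 h1 (h _ (h' _ hφ))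
    simpa using h2
  incl {a w v} h := World.rel_or_eq hL fun φ hφ => by
    have h1 := w.of_mem _ (hL.subst (fun _ => φ) _ (incl a))
    have h2 := (w.holds_imp (dia a φ) ((dia d φ).or φ)).1 h1 (h _ hφ)
    simpa using h2

lemma mem_of_incl {A : Type u} {L : Set (Formula A)} (hL : IsLogic L) (d : A) :
    imp (dia d (var 0)) ((dia d (var 0)).or (var 0)) ∈ L :=
  (mem_iff_forall_world hL).2 fun w => by simp +contextual

lemma isDifference_none (hM : IsLogic M) (h : ∀ φ, DiffAxiom A φ → φ ∈ M) :
    IsDifference M none :=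
  isDifference_of_axioms hM (h _ .symm) (h _ .trans) fun a => by
    cases a with
    | none => exact mem_of_incl hM none
    | some a => exact h _ (.incl a)

lemma isDifference_restrict (hM : IsLogic M) (h : ∀ φ, DiffAxiom A φ → φ ∈ M)
    (s : Finset (Option A)) (hs : none ∈ s) : IsDifference (restrict M s) ⟨none, hs⟩ :=
  isDifference_of_axioms (isLogic_restrict hM s) (h _ .symm) (h _ .trans) fun a => by
    rcases a with ⟨a, ha⟩
    cases a with
    | none => exact mem_of_incl (isLogic_restrict hM s) _
    | some a => exact h _ (.incl a)

/-- Reachability is contained in the symmetric relation `R_d ∪ id`, so the transitivity index and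
the height are at most 1. -/
lemma IsDifference.hasFiniteHeight {A : Type u} [Fintype A] {L : Set (Formula A)}
    (hL : IsLogic L) {d : A} (hd : IsDifference L d) : HasFiniteHeight L := by
  have h1 : ∀ {w v : World L}, RelAll w v → World.Rel d w v ∨ w = v := fun ⟨_, h⟩ => hd.incl h
  have h2 : ∀ {w v : World L}, Reach w v → World.Rel d w v ∨ w = v := by
    intro w v h
    induction h with
    | refl => exact .inr rfl
    | tail _ h ih =>
      rcases h1 h with h | rfl
      · rcases ih with h' | rfl
        · exact hd.trans h' h
        · exact .inl h
      · exact ih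
  have htr : tr A 1 ∈ L := by
    rw [mem_iff_forall_world hL]
    intro w
    rw [tr, World.holds_imp, World.holds_diaAll_iterate hL, World.holds_diaLe hL]
    rintro ⟨v, h3, h4⟩
    refine ⟨v, ?_, h4⟩
    rcases h2 (reflTransGen_iff_iter.2 ⟨_, h3⟩) with h | rfl
    · exact ⟨1, le_rfl, iter_one.2 ⟨d, h⟩⟩
    · exact ⟨0, by simp, rfl⟩
  refine ⟨1, 1, htr, (mem_iff_forall_world hL).2 fun w => ?_⟩
  rw [heightForm_succ, World.holds_imp, World.holds_neg, World.holds_diaLe_of_tr hL htr]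
  rintro h3 ⟨v, h4, h5⟩
  rw [World.holds_neg, World.holds_or, World.holds_diaLe_of_tr hL htr] at h5
  refine h5 (.inl ⟨w, ?_, h3⟩)
  rcases h2 h4 with h | rfl
  · exact .single ⟨d, hd.symm h⟩
  · exact .refl

/-! ### Elimination of the difference modality -/

/-- The component of the canonical frame that contains `w`. -/
def component (w : World M) : Set (World M) := {v | World.Rel none w v ∨ w = v}

lemma IsDifference.rel_of_mem_component (hM : IsDifference M none) {w u v : World M}
    (hu : u ∈ component w) (hv : v ∈ component w) (hne : u ≠ v) : World.Rel none u v := by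
  rcases hu with hu | rfl
  · rcases hv with hv | rfl
    · exact (hM.trans (hM.symm hu) hv).resolve_right hne
    · exact hM.symm hu
  · exact hv.resolve_right hne

lemma IsDifference.mem_component (hM : IsDifference M none) {w u v : World M} {a : Option A}
    (hu : u ∈ component w) (huv : World.Rel a u v) : v ∈ component w := by
  rcases hM.incl huv with h | rfl
  · rcases hu with hu | rfl
    · exact hM.trans hu h
    · exact .inl h
  · exact hu

/-- In a component, `⟨≠⟩φ` is equivalent to `⊥`, `⊤` or `¬φ`. -/
lemma IsDifference.dia_none_equiv (hL : IsLogic M) (hM : IsDifference M none) (w : World M)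
    (φ : Formula (Option A)) : ∃ χ ∈ ({bot, imp bot bot, neg φ} : Set (Formula (Option A))),
      ∀ v ∈ component w, v.holds (dia none φ) ↔ v.holds χ := by
  by_cases h0 : ∃ v ∈ component w, v.holds φ
  swap
  · push Not at h0
    refine ⟨bot, by simp, fun v hv => ?_⟩
    rw [World.holds_dia hL, World.holds_bot, iff_false]
    rintro ⟨u, h1, h2⟩
    exact h0 u (hM.mem_component hv h1) h2
  -- Such a `v` (reflexive, or one of several `φ`-points) makes `⟨≠⟩φ` true everywhere in the
  -- component, as all other points see `v`. Otherwise `⟨≠⟩φ` fails exactly at the points where `φ`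
  -- is true.
  by_cases h1 : ∃ v ∈ component w, v.holds φ ∧ v.holds (dia none φ)
  · obtain ⟨v, hv, h2, h3⟩ := h1
    refine ⟨imp bot bot, by simp, fun u hu => ?_⟩
    simp only [World.holds_imp, imp_self, iff_true]
    by_cases huv : u = v
    · exact huv ▸ h3
    · exact hM.rel_of_mem_component hu hv huv _ h2
  · push Not at h1
    obtain ⟨v, hv, h2⟩ := h0
    refine ⟨neg φ, by simp, fun u hu => ?_⟩
    rw [World.holds_neg]
    refine ⟨fun h3 h4 => h1 u hu h4 h3, fun h3 => ?_⟩
    have huv : u ≠ v := by rintro rfl; exact h3 h2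
    exact hM.rel_of_mem_component hu hv huv _ h2

/-- Translation into representatives `r t` of formulas over `A`, where `δ` gives the
translation of the difference modality. -/
def elimDiff {T : Type*} (τ : Formula A → T) (r : T → Formula A) (δ : T → T) :
    Formula (Option A) → T
  | var n => τ (var n)
  | bot => τ bot
  | imp φ ψ => τ (imp (r (elimDiff τ r δ φ)) (r (elimDiff τ r δ ψ)))
  | dia (some a) φ => τ (dia a (r (elimDiff τ r δ φ)))
  | dia none φ => δ (elimDiff τ r δ φ)

/-- On one component, `⟨≠⟩` sends representatives of `⟨≠⟩`-free `k`-formulas to such representatives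
by a map `δ : T → T`, so every `k`-formula is equivalent there to its translation `elimDiff τ r δ`.
-/
theorem LocallyTabular.of_pull_some (hM : IsLogic M) (hd : IsDifference M none)
    (h : LocallyTabular (ModalFH.pull some M)) : LocallyTabular M := by
  intro k
  obtain ⟨T, _, τ, r, hr, hτ⟩ := (h k).exists_representatives (isLogic_pull some hM)
  have hτ' : ∀ φ, IsKFormula k φ → ∀ w : World M,
      w.holds ((r (τ φ)).map some) ↔ w.holds (φ.map some) := by
    intro φ hφ w
    have h1 : (φ.map some).iff ((r (τ φ)).map some) ∈ M := hτ φ hφ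
    exact ((w.holds_iff _ _).1 (w.of_mem _ h1)).symm
  have hδ : ∀ w : World M, ∃ δ : T → T, ∀ t, ∀ v ∈ component w,
      v.holds (dia none ((r t).map some)) ↔ v.holds ((r (δ t)).map some) := by
    intro w
    have : ∀ t, ∃ t', ∀ v ∈ component w,
        v.holds (dia none ((r t).map some)) ↔ v.holds ((r t').map some) := by
      intro t
      obtain ⟨χ, hχ, h1⟩ := hd.dia_none_equiv hM w ((r t).map some)
      have h2 : ∃ χ', IsKFormula k χ' ∧ χ'.map some = χ := by
        rcases hχ with rfl | rfl | rfl
        · exact ⟨bot, trivial, rfl⟩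
        · exact ⟨imp bot bot, ⟨trivial, trivial⟩, rfl⟩
        · exact ⟨neg (r t), ⟨hr t, trivial⟩, rfl⟩
      obtain ⟨χ', h3, rfl⟩ := h2
      exact ⟨τ χ', fun v hv => (h1 v hv).trans (hτ' χ' h3 v).symm⟩
    choose δ hδ using this
    exact ⟨δ, hδ⟩
  have key : ∀ (w : World M) (δ : T → T), (∀ t, ∀ v ∈ component w,
      v.holds (dia none ((r t).map some)) ↔ v.holds ((r (δ t)).map some)) →
      ∀ φ, IsKFormula k φ → ∀ v ∈ component w,
        v.holds φ ↔ v.holds ((r (elimDiff τ r δ φ)).map some) := by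
    intro w δ hδ φ
    have hdia : ∀ (a : Option A) (φ ψ : Formula (Option A)),
        (∀ v ∈ component w, v.holds φ ↔ v.holds ψ) →
        ∀ v ∈ component w, v.holds (dia a φ) ↔ v.holds (dia a ψ) := by
      intro a φ ψ h v hv
      rw [World.holds_dia hM, World.holds_dia hM]
      exact exists_congr fun u => and_congr_right fun hu => h u (hd.mem_component hv hu)
    induction φ with
    | var n => exact fun hφ v _ => (hτ' (var n) hφ v).symm
    | bot => exact fun hφ v _ => (hτ' bot hφ v).symm
    | imp φ ψ h1 h2 =>
      intro hφ v hv
      rw [elimDiff, hτ' (imp _ _) ⟨hr _, hr _⟩, Formula.map, World.holds_imp, World.holds_imp,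
        h1 hφ.1 v hv, h2 hφ.2 v hv]
    | dia a φ h1 =>
      intro hφ v hv
      rw [hdia a _ _ (h1 hφ) v hv]
      cases a with
      | none => exact hδ _ v hv
      | some a => exact (hτ' (dia a _) (hr _) v).symm
  -- The map `δ` varies with the component, so a formula is recorded by its translations under all
  -- `δ`; the set `(T → T) → T` of records is finite.
  refine kFinite_of_finite hM (fun φ δ => elimDiff τ r δ φ) fun φ ψ hφ hψ hφψ => ?_
  rw [mem_iff_forall_world hM]
  intro w
  obtain ⟨δ, hδ⟩ := hδ w
  rw [World.holds_iff, key w δ hδ φ hφ w (.inr rfl), key w δ hδ ψ hψ w (.inr rfl),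
    show elimDiff τ r δ φ = elimDiff τ r δ ψ from congrFun hφψ δ]

end Difference

/-! ### Transfer of the finite height criterion -/

section Transfer

variable {A : Type u}

lemma hasFiniteHeight_restrict_map {M : Set (Formula (Option A))} (hM : IsLogic M)
    (s : Finset A) : HasFiniteHeight (restrict M (s.map Function.Embedding.some)) ↔
      HasFiniteHeight (restrict (pull some M) s) := by
  let e : s ≃ s.map Function.Embedding.some :=
    Equiv.ofBijective (fun a => ⟨some a, by simp⟩)
      ⟨fun a b h => Subtype.ext (Option.some.inj (congrArg Subtype.val h)), by
        rintro ⟨a, ha⟩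
        obtain ⟨b, hb, rfl⟩ := Finset.mem_map.1 ha
        exact ⟨⟨b, hb⟩, rfl⟩⟩
  have h1 : pull e (restrict M (s.map Function.Embedding.some)) = restrict (pull some M) s := by
    ext φ
    change (φ.map e).map Subtype.val ∈ M ↔ (φ.map Subtype.val).map some ∈ M
    rw [map_map, map_map]
    rfl
  have h2 : pull e.symm (restrict (pull some M) s) =
      restrict M (s.map Function.Embedding.some) := by
    rw [← h1]
    ext φ
    change (φ.map e.symm).map e ∈ restrict M _ ↔ φ ∈ restrict M _
    rw [map_map, Equiv.self_comp_symm, map_id]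
  constructor
  · intro h
    exact HasFiniteHeight.of_pull (isLogic_restrict (isLogic_pull some hM) s) e.symm.surjective
      (h2.symm ▸ h)
  · intro h
    exact HasFiniteHeight.of_pull (isLogic_restrict hM _) e.surjective (h1.symm ▸ h)

lemma forall_height_restrict_iff [Fintype A] {M : Set (Formula (Option A))} (hM : IsLogic M)
    (hd : ∀ φ, DiffAxiom A φ → φ ∈ M) :
    (∀ s : Finset (Option A), height (restrict M s) < ⊤) ↔
      ∀ s : Finset A, height (restrict (pull some M) s) < ⊤ := by
  constructor
  · intro h s
    rw [height_lt_top_iff (isLogic_restrict (isLogic_pull some hM) s),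
      ← hasFiniteHeight_restrict_map hM, ← height_lt_top_iff (isLogic_restrict hM _)]
    exact h _
  · intro h s
    rw [height_lt_top_iff (isLogic_restrict hM _)]
    by_cases hs : none ∈ s
    · exact (isDifference_restrict hM hd s hs).hasFiniteHeight (isLogic_restrict hM s)
    · obtain ⟨t, rfl⟩ : ∃ t : Finset A, s = t.map Function.Embedding.some := by
        refine ⟨Finset.eraseNone s, ?_⟩
        classical
        rw [Finset.map_some_eraseNone, Finset.erase_eq_of_notMem hs]
      rw [hasFiniteHeight_restrict_map hM,
        ← height_lt_top_iff (isLogic_restrict (isLogic_pull some hM) t)]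
      exact h t

theorem admitsFiniteHeightCriterion_diff_iff [Fintype A] {L : Set (Formula A)} :
    AdmitsFiniteHeightCriterion (diff L) ↔ AdmitsFiniteHeightCriterion L := by
  constructor
  · intro h N hN hLN
    refine ⟨fun hlt => hlt.height_restrict_lt_top hN, fun hfh => ?_⟩
    have hM := isLogic_diff N
    obtain ⟨h1, h2⟩ := (diff_subset_iff hM).1 subset_rfl
    have h3 := (h (diff N) hM ((diff_subset_iff hM).2 ⟨hLN.trans h1, h2⟩)).2
      ((forall_height_restrict_iff hM h2).2 (by rwa [pull_diff hN]))
    have h4 := h3.pull hM some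
    rwa [pull_diff hN] at h4
  · intro h M hM hLM
    refine ⟨fun hlt => hlt.height_restrict_lt_top hM, fun hfh => ?_⟩
    obtain ⟨h1, h2⟩ := (diff_subset_iff hM).1 hLM
    exact LocallyTabular.of_pull_some hM (isDifference_none hM h2)
      ((h _ (isLogic_pull some hM) h1).2 ((forall_height_restrict_iff hM h2).1 hfh))

end Transfer

/-! ### Bisimulations -/

section Bisimulation

variable {X κ : Type*}

/-- `Z` is a bisimulation of the model `(X, R, c)` with itself. -/
def IsBisim (R : X → X → Prop) (c : X → κ) (Z : X → X → Prop) : Prop :=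
  ∀ x y, Z x y → c x = c y ∧ (∀ x', R x x' → ∃ y', R y y' ∧ Z x' y') ∧
    (∀ y', R y y' → ∃ x', R x x' ∧ Z x' y')

/-- Bisimilarity in the model `(X, R, c)`. -/
def Bisimilar (R : X → X → Prop) (c : X → κ) (x y : X) : Prop := ∃ Z, IsBisim R c Z ∧ Z x y

lemma isBisim_bisimilar (R : X → X → Prop) (c : X → κ) : IsBisim R c (Bisimilar R c) := by
  rintro x y ⟨Z, hZ, hxy⟩
  obtain ⟨h1, h2, h3⟩ := hZ x y hxy
  refine ⟨h1, fun x' h => ?_, fun y' h => ?_⟩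
  · obtain ⟨y', h4, h5⟩ := h2 x' h
    exact ⟨y', h4, Z, hZ, h5⟩
  · obtain ⟨x', h4, h5⟩ := h3 y' h
    exact ⟨x', h4, Z, hZ, h5⟩

/-- A symmetric relation with the forth condition is a bisimulation. -/
lemma isBisim_of_symm {R : X → X → Prop} {c : X → κ} {Z : X → X → Prop}
    (symm : ∀ x y, Z x y → Z y x) (hc : ∀ x y, Z x y → c x = c y)
    (forth : ∀ x y, Z x y → ∀ x', R x x' → ∃ y', R y y' ∧ Z x' y') : IsBisim R c Z := by
  refine fun x y h => ⟨hc x y h, forth x y h, fun y' h' => ?_⟩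
  obtain ⟨x', h1, h2⟩ := forth y x (symm x y h) y' h'
  exact ⟨x', h1, symm _ _ h2⟩

lemma Bisimilar.symm {R : X → X → Prop} {c : X → κ} {x y : X} (h : Bisimilar R c x y) :
    Bisimilar R c y x := by
  obtain ⟨Z, hZ, hxy⟩ := h
  exact ⟨fun a b => Z b a, fun a b hab =>
    ⟨(hZ b a hab).1.symm, (hZ b a hab).2.2, (hZ b a hab).2.1⟩, hxy⟩

/-- On `U`, the model `(X, R, c)` has finitely many points up to bisimilarity. -/
def FinitelyManyTypes (R : X → X → Prop) (c : X → κ) (U : Set X) : Prop :=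
  ∃ (T : Type) (_ : Finite T) (τ : X → T), ∀ x ∈ U, ∀ y ∈ U, τ x = τ y → Bisimilar R c x y

lemma finitelyManyTypes_of_finite {R : X → X → Prop} {c : X → κ} {U : Set X} {T : Type*}
    [Finite T] (τ : X → T) (h : ∀ x ∈ U, ∀ y ∈ U, τ x = τ y → Bisimilar R c x y) :
    FinitelyManyTypes R c U := by
  obtain ⟨n, ⟨e⟩⟩ := Finite.exists_equiv_fin T
  exact ⟨Fin n, inferInstance, e ∘ τ, fun x hx y hy hxy => h x hx y hy (e.injective hxy)⟩

end Bisimulation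

/-! ### Clusters in frames with `R ^ (m + 1) ⊆ R ∪ id` -/

section Cluster

variable {X : Type*} {R : X → X → Prop} {m : ℕ}

lemma iter_of_walk {f : ℕ → X} {i n : ℕ} (h : ∀ t < n, R (f (i + t)) (f (i + t + 1))) :
    iter R n (f i) (f (i + n)) := by
  induction n with
  | zero => rfl
  | succ n ih => exact iter_add (ih fun t ht => h t (by omega)) (iter_one.2 (h n (by omega)))

lemma exists_walk_of_iter {n : ℕ} {x y : X} (h : iter R n x y) :
    ∃ f : ℕ → X, f 0 = x ∧ f n = y ∧ ∀ t < n, R (f t) (f (t + 1)) := by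
  induction n generalizing x with
  | zero => exact ⟨fun _ => x, rfl, h, by simp⟩
  | succ n ih =>
    obtain ⟨z, h1, h2⟩ := h
    obtain ⟨f, h3, h4, h5⟩ := ih h2
    refine ⟨fun t => t.casesOn x f, rfl, h4, fun t ht => ?_⟩
    cases t with
    | zero => simpa [h3] using h1
    | succ t => exact h5 t (by omega)

lemma iter_mul {n : ℕ} {x : X} (h : iter R n x x) (k : ℕ) : iter R (n * k) x x := by
  induction k with
  | zero => rfl
  | succ k ih => exact iter_add ih h

/-- A cluster is saturated if walks of length `≡ 1 (mod m)` between distinct points reduce to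
edges. -/
def Saturated (R : X → X → Prop) (m : ℕ) (x : X) : Prop :=
  ∀ y z, Relation.ReflTransGen R x y → Relation.ReflTransGen R x z → ∀ j, iter R (m * j + 1) y z →
    y ≠ z → R y z

/-- If the points of a closed walk of length `m + 1` do not exhaust a cluster, then each two
distinct points of the walk are related. -/
lemma rel_of_closed_walk (hm : 0 < m) (hR : ∀ x y, iter R (m + 1) x y → R x y ∨ x = y)
    (hsymm : ∀ x y, Relation.ReflTransGen R x y → Relation.ReflTransGen R y x)
    {g : ℕ → X} (hper : ∀ i, g (i + (m + 1)) = g i) (hg : ∀ i, R (g i) (g (i + 1)))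
    {w : X} (hw : Relation.ReflTransGen R (g 0) w) (hwg : ∀ i, g i ≠ w) {l : ℕ}
    (hl : g 0 ≠ g l) : R (g 0) (g l) := by
  have hper' : ∀ i k, g (i + (m + 1) * k) = g i := by
    intro i k
    induction k with
    | zero => rfl
    | succ k ih => rw [Nat.mul_succ, ← add_assoc, hper, ih]
  have walk : ∀ i n, iter R n (g i) (g (i + n)) := fun i n => iter_of_walk fun t _ => hg _
  -- From the point after `g (i + s)`, `m` steps around the closed walk return to `g (i + s)`, and
  -- one more leads to `u`.
  have out : ∀ i u, R (g i) u → (∀ t, g t ≠ u) → ∀ t, R (g t) u := by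
    intro i u h hu t
    have : ∀ s, R (g (i + s)) u := by
      intro s
      induction s with
      | zero => exact h
      | succ s ih =>
        have h1 := walk (i + s + 1) m
        rw [show i + s + 1 + m = i + s + (m + 1) by ring, hper] at h1
        exact (hR _ _ (iter_add h1 (iter_one.2 ih))).resolve_right (hu _)
    have h2 := this (t + m * i)
    rwa [show i + (t + m * i) = t + (m + 1) * i by ring, hper'] at h2
  have out' : ∀ u v, (∀ t, R (g t) u) → R u v → (∀ t, g t ≠ v) → ∀ t, R (g t) v := by
    intro u v h h' hv t
    have h1 := iter_add (walk t (m - 1)) (iter_add (iter_one.2 (h _)) (iter_one.2 h'))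
    rw [show m - 1 + (1 + 1) = m + 1 by omega] at h1
    exact (hR _ _ h1).resolve_right (hv t)
  -- A path to `w` leaves the closed walk, and the point where it leaves is seen from the whole
  -- walk.
  have h1 : (∃ t, g t = w) ∨ ∃ u, (∀ t, g t ≠ u) ∧ (∀ t, R (g t) u) := by
    clear hwg
    induction hw with
    | refl => exact .inl ⟨0, rfl⟩
    | @tail u v _ h ih =>
      rcases ih with ⟨t, rfl⟩ | ih
      · by_cases hv : ∃ s, g s = v
        · exact .inl hv
        · push Not at hv
          exact .inr ⟨v, hv, out t v h hv⟩
      · exact .inr ih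
  obtain ⟨u, hu, hgu⟩ := h1.resolve_left (by simpa using hwg)
  have hu0 : Relation.ReflTransGen R u (g 0) := hsymm _ _ (.single (hgu 0))
  -- A path from `u` back to the closed walk consists of points seen from the whole walk, up to the
  -- point `z` from which it re-enters.
  have h2 : ∀ v, Relation.ReflTransGen R u v → ((∀ t, g t ≠ v) ∧ (∀ t, R (g t) v)) ∨
      ∃ z, (∀ t, g t ≠ z) ∧ (∀ t, R (g t) z) ∧ ∃ t, R z (g t) := by
    intro v hv
    induction hv with
    | refl => exact .inl ⟨hu, hgu⟩
    | @tail a b _ h ih =>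
      rcases ih with ⟨h3, h4⟩ | ih
      · by_cases hb : ∃ s, g s = b
        · obtain ⟨s, rfl⟩ := hb
          exact .inr ⟨a, h3, h4, s, h⟩
        · push Not at hb
          exact .inl ⟨hb, out' a b h4 h hb⟩
      · exact .inr ih
  obtain ⟨z, hz, hgz, i, hzi⟩ := (h2 _ hu0).resolve_left fun h => h.1 0 rfl
  -- Entering the walk at `g (t + d + 1)` and going `m` further steps around it ends at `g (t + d)`,
  -- so `z` sees the preceding point too, and eventually all of them.
  have down : ∀ d t, R z (g (t + d)) → R z (g t) := by
    intro d
    induction d with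
    | zero => exact fun t h => h
    | succ d ih =>
      intro t h
      refine ih t ?_
      have h3 := walk (t + (d + 1)) m
      rw [show t + (d + 1) + m = t + d + (m + 1) by ring, hper] at h3
      have h4 := iter_add (iter_one.2 h) h3
      rw [add_comm] at h4
      exact (hR _ _ h4).resolve_right fun h => hz _ h.symm
  have hzl : R z (g l) := by
    refine down (i + m * l) l ?_
    rw [show l + (i + m * l) = i + (m + 1) * l by ring, hper']
    exact hzi
  -- A detour of `m + 1` steps: `m - 1` along the walk, one to `z`, one to `g l`.
  have h5 := iter_add (walk 0 (m - 1)) (iter_add (iter_one.2 (hgz _)) (iter_one.2 hzl))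
  rw [show m - 1 + (1 + 1) = m + 1 by omega] at h5
  exact (hR _ _ h5).resolve_right hl

/-- A shortest walk of length `≡ 1 (mod m)` violating saturation cannot be shortened, which makes it
periodic with period `m + 1`; it therefore winds around a closed walk. By `rel_of_closed_walk`, a
point of the cluster outside that closed walk would give the missing edge. -/
lemma saturated_or_small (hm : 0 < m) (hR : ∀ x y, iter R (m + 1) x y → R x y ∨ x = y)
    (hsymm : ∀ x y, Relation.ReflTransGen R x y → Relation.ReflTransGen R y x) (x₀ : X) :
    Saturated R m x₀ ∨ ∃ g : Fin (m + 1) → X, ∀ w, Relation.ReflTransGen R x₀ w ↔ ∃ i, g i = w := by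
  by_contra! hcon
  obtain ⟨hsat, hsmall⟩ := hcon
  simp only [Saturated] at hsat
  push Not at hsat
  obtain ⟨x, y, hx, hy, j₀, hj₀, hne, hxy⟩ := hsat
  have hj : ∃ j, iter R (m * j + 1) x y := ⟨j₀, hj₀⟩
  classical
  obtain ⟨j, hj, hmin⟩ : ∃ j, iter R (m * j + 1) x y ∧ ∀ i < j, ¬ iter R (m * i + 1) x y :=
    ⟨Nat.find hj, Nat.find_spec hj, fun i hi => Nat.find_min hj hi⟩
  have hj2 : 2 ≤ j := by
    by_contra h
    interval_cases j
    · exact hxy (iter_one.1 hj)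
    · exact (hR x y (by simpa using hj)).elim hxy hne
  obtain ⟨j, rfl⟩ := Nat.exists_eq_add_of_le' hj2
  obtain ⟨f, hf0, hfN, hf⟩ := exists_walk_of_iter hj
  set N := m * (j + 2) + 1 with hN
  have hN' : N = m * j + m + m + 1 := by rw [hN]; ring
  -- Otherwise the `m + 1` steps between these points are replaced by one edge, which shortens the
  -- walk by `m` and contradicts minimality.
  have hfper : ∀ i, i + (m + 1) ≤ N → f i = f (i + (m + 1)) := by
    intro i hi
    by_contra hne'
    have h1 : iter R (m + 1) (f i) (f (i + (m + 1))) := iter_of_walk fun t ht => hf _ (by omega)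
    have h2 := (hR _ _ h1).resolve_right hne'
    have h3 : iter R i (f 0) (f (0 + i)) := iter_of_walk fun t ht => hf _ (by omega)
    have h4 : iter R (N - (i + (m + 1))) (f (i + (m + 1)))
        (f (i + (m + 1) + (N - (i + (m + 1))))) := iter_of_walk fun t ht => hf _ (by omega)
    rw [zero_add, hf0] at h3
    rw [show i + (m + 1) + (N - (i + (m + 1))) = N by omega, hfN] at h4
    have h5 := iter_add h3 (iter_add (iter_one.2 h2) h4)
    refine hmin (j + 1) (by omega) ?_
    rwa [show i + (1 + (N - (i + (m + 1)))) = m * (j + 1) + 1 by rw [mul_add]; omega] at h5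
  have hfm : ∀ i ≤ N, ∃ t < m + 1, f i = f t := by
    intro i
    induction i using Nat.strong_induction_on with
    | _ i ih =>
      intro hi
      by_cases h : i < m + 1
      · exact ⟨i, h, rfl⟩
      · obtain ⟨t, ht, h'⟩ := ih (i - (m + 1)) (by omega) (by omega)
        refine ⟨t, ht, ?_⟩
        rw [← h', hfper (i - (m + 1)) (by omega)]
        congr 1; omega
  let g : ℕ → X := fun i => f (i % (m + 1))
  have hgper : ∀ i, g (i + (m + 1)) = g i := fun i => by simp [g]
  have hgstep : ∀ i, R (g i) (g (i + 1)) := by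
    intro i
    have hlt : i % (m + 1) < m + 1 := Nat.mod_lt _ (by omega)
    have h1 := hf (i % (m + 1)) (by omega)
    by_cases h : i % (m + 1) = m
    · have h2 : (i + 1) % (m + 1) = 0 := by rw [Nat.add_mod, h]; simp
      have h3 := hfper 0 (by omega)
      simp only [g, h2, h, h3] at h1 ⊢
      simpa using h1
    · have h2 : (i + 1) % (m + 1) = i % (m + 1) + 1 := by
        rw [Nat.add_mod, Nat.mod_eq_of_lt (a := 1) (by omega), Nat.mod_eq_of_lt (by omega)]
      simp only [g, h2]
      exact h1
  have hg0 : g 0 = x := by simp [g, hf0]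
  obtain ⟨l, hl, hgl⟩ := hfm N le_rfl
  have hgl : g l = y := by simp only [g, Nat.mod_eq_of_lt hl, ← hgl, hfN]
  have hreach : ∀ i, Relation.ReflTransGen R x (g i) := by
    intro i
    rw [← hg0]
    induction i with
    | zero => exact .refl
    | succ i ih => exact ih.tail (hgstep i)
  obtain ⟨w, ⟨h1, h2⟩ | ⟨h1, i, h2⟩⟩ := hsmall (fun i => g i)
  · refine hxy ?_
    rw [← hg0, ← hgl]
    refine rel_of_closed_walk hm hR hsymm hgper hgstep (w := w) ?_ ?_ (by rwa [hg0, hgl])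
    · rw [hg0]; exact (hsymm _ _ hx).trans h1
    · intro i
      have := h2 ⟨i % (m + 1), Nat.mod_lt _ (by omega)⟩
      simpa [g] using this
  · exact h1 (h2 ▸ hx.trans (hreach i))

/-! #### Types of points in clusters -/

/-- There is a walk from `x` to `y` of length `i` modulo `m`. -/
def WalkMod (R : X → X → Prop) (m : ℕ) (i : ZMod m) (x y : X) : Prop :=
  ∃ n : ℕ, (n : ZMod m) = i ∧ iter R n x y

lemma WalkMod.trans {i j : ZMod m} {x y z : X} (h : WalkMod R m i x y) (h' : WalkMod R m j y z) :
    WalkMod R m (i + j) x z := by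
  obtain ⟨a, rfl, ha⟩ := h
  obtain ⟨b, rfl, hb⟩ := h'
  exact ⟨a + b, by push_cast; rfl, iter_add ha hb⟩

lemma WalkMod.of_rel {x y : X} (h : R x y) : WalkMod R m 1 x y := ⟨1, by simp, iter_one.2 h⟩

lemma WalkMod.reach {i : ZMod m} {x y : X} (h : WalkMod R m i x y) :
    Relation.ReflTransGen R x y := by
  obtain ⟨n, -, hn⟩ := h
  exact reflTransGen_iff_iter.2 ⟨n, hn⟩

lemma WalkMod.symm (hm : 0 < m)
    (hsymm : ∀ x y, Relation.ReflTransGen R x y → Relation.ReflTransGen R y x) {i : ZMod m}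
    {x y : X} (h : WalkMod R m i x y) : WalkMod R m (-i) y x := by
  obtain ⟨n', hn'⟩ := reflTransGen_iff_iter.1 (hsymm _ _ h.reach)
  obtain ⟨n, rfl, hn⟩ := h
  -- Going `m - 1` times around the closed tour of length `n' + n` contributes `-(n' + n)` modulo
  -- `m`; the final return of length `n'` leaves `-n`.
  refine ⟨(n' + n) * (m - 1) + n', ?_, iter_add (iter_mul (iter_add hn' hn) (m - 1)) hn'⟩
  push_cast [Nat.cast_sub (show 1 ≤ m from hm)]
  simp

lemma Saturated.rel {x y z : X} (h : Saturated R m x) (hy : Relation.ReflTransGen R x y)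
    (hyz : WalkMod R m 1 y z) (hne : y ≠ z) : R y z := by
  obtain ⟨n, h1, hn⟩ := hyz
  cases n with
  | zero => exact (hne hn).elim
  | succ n =>
    have h2 : (n : ZMod m) = 0 := by simpa using h1
    obtain ⟨j, rfl⟩ := (ZMod.natCast_eq_zero_iff n m).1 h2
    exact h y z hy (hy.trans (reflTransGen_iff_iter.2 ⟨_, hn⟩)) j hn hne

lemma Saturated.of_reach {x y : X} (h : Saturated R m x) (hy : Relation.ReflTransGen R x y) :
    Saturated R m y := fun a b ha hb => h a b (hy.trans ha) (hy.trans hb)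

variable {κ : Type*}

/-- The colour of a point together with the colours of its successors. -/
def colour₁ (R : X → X → Prop) (c : X → κ) (x : X) : κ × Set κ := (c x, {s | ∃ y, R x y ∧ c y = s})

/-- The colours that occur at the points of a cluster, sorted by distance from `x` modulo `m`. -/
def distColours (R : X → X → Prop) (m : ℕ) (c : X → κ) (x : X) (i : ZMod m) : Set (κ × Set κ) :=
  {s | ∃ y, WalkMod R m i x y ∧ colour₁ R c y = s}

lemma distColours_eq (hm : 0 < m)
    (hsymm : ∀ x y, Relation.ReflTransGen R x y → Relation.ReflTransGen R y x) (c : X → κ)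
    {i j : ZMod m} {x y : X} (h : WalkMod R m j x y) :
    distColours R m c y i = distColours R m c x (j + i) := by
  ext s
  constructor
  · rintro ⟨z, h1, h2⟩
    exact ⟨z, h.trans h1, h2⟩
  · rintro ⟨z, h1, h2⟩
    refine ⟨z, ?_, h2⟩
    have := (h.symm hm hsymm).trans h1
    rwa [neg_add_cancel_left] at this

/-- Along an edge the distance colours are merely shifted by 1, so the forth condition only requires
a successor of `y` with the right `colour₁`. Distance colours provide a candidate at distance 1, and
saturation makes it a successor unless it is `y` itself. -/
lemma bisimilar_of_saturated (hm : 0 < m)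
    (hsymm : ∀ x y, Relation.ReflTransGen R x y → Relation.ReflTransGen R y x) (c : X → κ)
    {x y : X} (hx : Saturated R m x) (hy : Saturated R m y) (h1 : colour₁ R c x = colour₁ R c y)
    (h2 : distColours R m c x = distColours R m c y) : Bisimilar R c x y := by
  refine ⟨fun x y => Saturated R m x ∧ Saturated R m y ∧ colour₁ R c x = colour₁ R c y ∧
    distColours R m c x = distColours R m c y, isBisim_of_symm ?_ ?_ ?_, hx, hy, h1, h2⟩
  · exact fun x y h => ⟨h.2.1, h.1, h.2.2.1.symm, h.2.2.2.symm⟩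
  · exact fun x y h => congrArg Prod.fst h.2.2.1
  clear hx hy h1 h2 x y
  rintro x y ⟨hx, hy, h1, h2⟩ z hxz
  suffices H : ∃ z', R y z' ∧ colour₁ R c z' = colour₁ R c z by
    obtain ⟨z', h3, h4⟩ := H
    refine ⟨z', h3, hx.of_reach (.single hxz), hy.of_reach (.single h3), h4.symm, ?_⟩
    funext i
    rw [distColours_eq hm hsymm c (WalkMod.of_rel hxz),
      distColours_eq hm hsymm c (WalkMod.of_rel h3), h2]
  obtain ⟨z', hz', hcz⟩ : colour₁ R c z ∈ distColours R m c y 1 :=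
    h2 ▸ ⟨z, WalkMod.of_rel hxz, rfl⟩
  by_cases hyz : y = z'
  swap
  · exact ⟨z', hy.rel .refl hz' hyz, hcz⟩
  subst hyz
  by_cases hyy : R y y
  · exact ⟨y, hyy, hcz⟩
  -- Here `y` is irreflexive but at distance 1 from itself, so all distances modulo `m` occur
  -- between points of its cluster, and by saturation distinct points are related. The equality of
  -- `colour₁` at `x` and `y` yields a successor `y' ≠ y` of the same colour as `y`; these two see
  -- each other and the same other points, so `colour₁` agrees on them.
  have seen : ∀ a b : X, colour₁ R c a = colour₁ R c b → ∀ u, R a u → ∃ v, R b v ∧ c v = c u := by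
    intro a b hab u hu
    have : c u ∈ (colour₁ R c b).2 := hab ▸ ⟨u, hu, rfl⟩
    exact this
  obtain ⟨y', hy', hcy'⟩ := seen x y h1 z hxz
  have hcy : c y' = c y := hcy'.trans (congrArg Prod.fst hcz).symm
  have hne : y ≠ y' := by rintro rfl; exact hyy hy'
  refine ⟨y', hy', ?_⟩
  rw [← hcz]
  have hw : WalkMod R m 1 y y' := .of_rel hy'
  have hw' := hw.symm hm hsymm
  refine Prod.ext hcy (Set.ext fun s => ⟨?_, ?_⟩)
  · rintro ⟨u, hu, rfl⟩
    by_cases h : u = y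
    · exact ⟨y', hy', by rw [h, hcy]⟩
    · refine ⟨u, hy.rel .refl ?_ (Ne.symm h), rfl⟩
      have := (hz'.symm hm hsymm).trans (hw.trans (.of_rel hu))
      simpa using this
  · rintro ⟨u, hu, rfl⟩
    by_cases h : u = y'
    · refine ⟨y, hy.rel hw.reach ?_ hne.symm, by rw [h, hcy]⟩
      simpa using hw'.trans (hz'.trans hz')
    · refine ⟨u, hy.rel hw.reach ?_ (Ne.symm h), rfl⟩
      simpa using hw'.trans (hz'.trans (.of_rel hu))

lemma bisimilar_of_small {ι : Type*} (c : X → κ) {x y : X} {g h : ι → X}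
    (hg : ∀ w, Relation.ReflTransGen R x w ↔ ∃ i, g i = w)
    (hh : ∀ w, Relation.ReflTransGen R y w ↔ ∃ i, h i = w) (hc : ∀ i, c (g i) = c (h i))
    (hR : ∀ i j, R (g i) (g j) ↔ R (h i) (h j)) {i : ι} (hx : g i = x) (hy : h i = y) :
    Bisimilar R c x y := by
  refine ⟨fun u v => ∃ i, g i = u ∧ h i = v, ?_, i, hx, hy⟩
  rintro _ _ ⟨i, rfl, rfl⟩
  refine ⟨hc i, fun u hu => ?_, fun v hv => ?_⟩
  · obtain ⟨j, rfl⟩ := (hg u).1 (((hg _).2 ⟨i, rfl⟩).tail hu)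
    exact ⟨h j, (hR i j).1 hu, j, rfl, rfl⟩
  · obtain ⟨j, rfl⟩ := (hh v).1 (((hh _).2 ⟨i, rfl⟩).tail hv)
    exact ⟨g j, (hR i j).2 hv, j, rfl, rfl⟩

/-- A frame that is a disjoint union of clusters and satisfies `R ^ (m + 1) ⊆ R ∪ id` has finitely
many points up to bisimilarity, for each finite colouring. -/
lemma finitelyManyTypes_of_clusters [Finite κ] (hm : 0 < m)
    (hR : ∀ x y, iter R (m + 1) x y → R x y ∨ x = y)
    (hsymm : ∀ x y, Relation.ReflTransGen R x y → Relation.ReflTransGen R y x) (c : X → κ) :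
    FinitelyManyTypes R c Set.univ := by
  have hsmall : ∀ x, ∃ (g : Fin (m + 1) → X) (i : Fin (m + 1)), ¬ Saturated R m x →
      g i = x ∧ ∀ w, Relation.ReflTransGen R x w ↔ ∃ i, g i = w := by
    intro x
    by_cases hx : Saturated R m x
    · exact ⟨fun _ => x, 0, fun h => (h hx).elim⟩
    · obtain ⟨g, hg⟩ := (saturated_or_small hm hR hsymm x).resolve_left hx
      obtain ⟨i, hi⟩ := (hg x).1 .refl
      exact ⟨g, i, fun _ => ⟨hi, hg⟩⟩
  choose g i hgi using hsmall
  have : NeZero m := ⟨hm.ne'⟩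
  let τ : X → Prop × ((κ × Set κ) × (ZMod m → Set (κ × Set κ))) ×
      (Fin (m + 1) × (Fin (m + 1) → κ) × (Fin (m + 1) → Fin (m + 1) → Prop)) := fun x =>
    (Saturated R m x, (colour₁ R c x, distColours R m c x),
      (i x, c ∘ g x, fun a b => R (g x a) (g x b)))
  refine finitelyManyTypes_of_finite τ fun x _ y _ h => ?_
  simp only [τ, Prod.mk.injEq] at h
  obtain ⟨h1, ⟨h2, h3⟩, h4, h5, h6⟩ := h
  by_cases hx : Saturated R m x
  · exact bisimilar_of_saturated hm hsymm c hx (h1 ▸ hx) h2 h3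
  · obtain ⟨h7, h8⟩ := hgi x hx
    obtain ⟨h9, h10⟩ := hgi y (h1 ▸ hx)
    exact bisimilar_of_small c h8 h10 (fun a => congrFun h5 a)
      (fun a b => Iff.of_eq (congrFun (congrFun h6 a) b)) h7 (h4 ▸ h9)

end Cluster

/-! ### Frames of finite height -/

section Height

variable {X : Type*} {R : X → X → Prop} {m : ℕ}

/-- The points of height at most `h`. -/
def heightSet (R : X → X → Prop) : ℕ → Set X
  | 0 => ∅
  | h + 1 => {x | ∀ y, Relation.ReflTransGen R x y →
      Relation.ReflTransGen R y x ∨ y ∈ heightSet R h}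

lemma heightSet_upward (h : ℕ) {x y : X} (hx : x ∈ heightSet R h)
    (hxy : Relation.ReflTransGen R x y) : y ∈ heightSet R h := by
  induction h generalizing x y with
  | zero => exact hx
  | succ h ih =>
    intro z hyz
    rcases hx z (hxy.trans hyz) with h' | h'
    · exact .inl (h'.trans hxy)
    · exact .inr h'

/-- The top layer is a disjoint union of clusters. Colouring its points additionally by the types of
their successors of lower height reduces the step to `finitelyManyTypes_of_clusters`; the resulting
bisimilarity on the layer is glued to bisimilarity in the whole frame. -/
lemma finitelyManyTypes_heightSet {κ : Type*} [Finite κ] (hm : 0 < m)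
    (hR : ∀ x y, iter R (m + 1) x y → R x y ∨ x = y) (c : X → κ) (h : ℕ) :
    FinitelyManyTypes R c (heightSet R h) := by
  induction h with
  | zero => exact ⟨Unit, inferInstance, fun _ => (), fun x hx => hx.elim⟩
  | succ h ih =>
    obtain ⟨T, _, τ, hτ⟩ := ih
    let D := {x // x ∈ heightSet R (h + 1) ∧ x ∉ heightSet R h}
    let RD : D → D → Prop := fun x y => R x y
    let cD : D → κ × Set T := fun x => (c x, {t | ∃ y ∈ heightSet R h, R x y ∧ τ y = t})
    have hiter : ∀ n (x y : D), iter RD n x y → iter R n x.1 y.1 := by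
      intro n
      induction n with
      | zero => exact fun x y h => congrArg Subtype.val h
      | succ n ih => rintro x y ⟨z, h1, h2⟩; exact ⟨z, h1, ih z y h2⟩
    -- A path that ends in the layer never leaves it, since both height sets are closed under
    -- reachability.
    have hlift : ∀ x y : D, ∀ z, Relation.ReflTransGen R x.1 z → Relation.ReflTransGen R z y.1 →
        ∀ hz, Relation.ReflTransGen RD x ⟨z, hz⟩ := by
      intro x y z hxz hzy
      induction hxz with
      | refl => exact fun _ => .refl
      | @tail a b h1 h2 ih =>
        intro hz
        have ha : a ∈ heightSet R (h + 1) ∧ a ∉ heightSet R h :=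
          ⟨heightSet_upward _ x.2.1 h1, fun ha => hz.2 (heightSet_upward _ ha (.single h2))⟩
        exact (ih (.head h2 hzy) ha).tail (b := ⟨a, ha⟩) h2
    obtain ⟨T', _, τ', hτ'⟩ := finitelyManyTypes_of_clusters (R := RD) (m := m) hm (by
        intro x y hxy
        exact (hR _ _ (hiter _ _ _ hxy)).imp id Subtype.ext) (by
        intro x y hxy
        have hxy' : Relation.ReflTransGen R x.1 y.1 := by
          obtain ⟨n, hn⟩ := reflTransGen_iff_iter.1 hxy
          exact reflTransGen_iff_iter.2 ⟨n, hiter n x y hn⟩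
        have hyx := (x.2.1 y.1 hxy').resolve_right y.2.2
        exact hlift y x x.1 hyx .refl x.2) cD
    classical
    refine finitelyManyTypes_of_finite (T := Option T × Option T')
      (fun x => (if x ∈ heightSet R h then some (τ x) else none,
        if hx : x ∈ heightSet R (h + 1) ∧ x ∉ heightSet R h then some (τ' ⟨x, hx⟩) else none)) ?_
    intro x hx y hy hxy
    simp only [Prod.mk.injEq] at hxy
    obtain ⟨h1, h2⟩ := hxy
    by_cases hxh : x ∈ heightSet R h
    · by_cases hyh : y ∈ heightSet R h
      · rw [if_pos hxh, if_pos hyh] at h1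
        exact hτ x hxh y hyh (Option.some.inj h1)
      · simp [hxh, hyh] at h1
    · have hyh : y ∉ heightSet R h := by
        intro hyh
        simp [hxh, hyh] at h1
      rw [dif_pos ⟨hx, hxh⟩, dif_pos ⟨hy, hyh⟩] at h2
      have hD := hτ' _ trivial _ trivial (Option.some.inj h2)
      refine ⟨fun u v => Bisimilar R c u v ∨ ∃ hu hv, Bisimilar RD cD ⟨u, hu⟩ ⟨v, hv⟩,
        isBisim_of_symm ?_ ?_ ?_, .inr ⟨_, _, hD⟩⟩
      · rintro u v (huv | ⟨hu, hv, huv⟩)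
        · exact .inl huv.symm
        · exact .inr ⟨hv, hu, huv.symm⟩
      · rintro u v (huv | ⟨hu, hv, huv⟩)
        · exact (isBisim_bisimilar R c u v huv).1
        · exact congrArg Prod.fst (isBisim_bisimilar RD cD _ _ huv).1
      · rintro u v (huv | ⟨hu, hv, huv⟩) u' huu'
        · obtain ⟨v', h3, h4⟩ := (isBisim_bisimilar R c u v huv).2.1 u' huu'
          exact ⟨v', h3, .inl h4⟩
        · obtain ⟨h3, h4, -⟩ := isBisim_bisimilar RD cD _ _ huv
          by_cases hu' : u' ∈ heightSet R h
          · have : τ u' ∈ (cD ⟨v, hv⟩).2 := h3 ▸ ⟨u', hu', huu', rfl⟩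
            obtain ⟨v', h5, h6, h7⟩ := this
            exact ⟨v', h6, .inl (hτ _ hu' _ h5 h7.symm)⟩
          · obtain ⟨⟨v', hv'⟩, h5, h6⟩ :=
              h4 ⟨u', heightSet_upward _ hu.1 (.single huu'), hu'⟩ huu'
            exact ⟨v', h5, .inr ⟨_, _, h6⟩⟩

end Height

/-! ### Unimodal logics with `◇^{m+1} p → ◇p ∨ p` -/

section Unimodal

variable {L : Set (Formula Unit)} {m : ℕ}

lemma relAll_unit_iff {w v : World L} : RelAll w v ↔ World.Rel () w v :=
  ⟨fun ⟨_, h⟩ => h, fun h => ⟨(), h⟩⟩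

lemma World.holds_dia_iterate_of_iter {n : ℕ} {w v : World L} (h : iter RelAll n w v)
    {φ : Formula Unit} (hφ : v.holds φ) : w.holds ((dia ())^[n] φ) := by
  induction n generalizing w with
  | zero => obtain rfl : w = v := h; exact hφ
  | succ n ih =>
    obtain ⟨u, h1, h2⟩ := h
    rw [Function.iterate_succ_apply']
    exact relAll_unit_iff.1 h1 _ (ih h2)

lemma subst_dia_iterate (σ : ℕ → Formula Unit) (n : ℕ) (φ : Formula Unit) :
    ((dia ())^[n] φ).subst σ = (dia ())^[n] (φ.subst σ) := by
  induction n with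
  | zero => rfl
  | succ n ih => simp only [Function.iterate_succ_apply', subst, ih]

lemma relAll_or_eq_of_iter (hL : IsLogic L)
    (hm : imp ((dia ())^[m + 1] (var 0)) ((dia () (var 0)).or (var 0)) ∈ L) {w v : World L}
    (h : iter RelAll (m + 1) w v) : RelAll w v ∨ w = v := by
  rw [relAll_unit_iff]
  refine World.rel_or_eq hL fun φ hφ => ?_
  have h1 := w.of_mem _ (hL.subst (fun _ => φ) _ hm)
  rw [subst, subst_dia_iterate, World.holds_imp] at h1
  exact (w.holds_or _ _).1 (h1 (World.holds_dia_iterate_of_iter h hφ))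

end Unimodal

/-! ### Canonicity of the height formulas. -/

section Canonical

variable {A : Type u} {L : Set (Formula A)}

lemma subst_congr {σ ρ : ℕ → Formula A} {k : ℕ} {φ : Formula A} (hφ : IsKFormula k φ)
    (h : ∀ i < k, σ i = ρ i) : φ.subst σ = φ.subst ρ := by
  induction φ with
  | var n => exact h n hφ
  | bot => rfl
  | imp φ ψ h1 h2 => simp only [subst, h1 hφ.1, h2 hφ.2]
  | dia a φ h1 => simp only [subst, h1 hφ]

lemma isKFormula_mono {k l : ℕ} (hkl : k ≤ l) {φ : Formula A} (h : IsKFormula k φ) :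
    IsKFormula l φ := by
  induction φ with
  | var n => exact lt_of_lt_of_le h hkl
  | bot => trivial
  | imp φ ψ h1 h2 => exact ⟨h1 h.1, h2 h.2⟩
  | dia a φ h1 => exact h1 h

lemma isKFormula_heightForm [Fintype A] (n h : ℕ) : IsKFormula (h + 1) (heightForm A n h) := by
  induction h with
  | zero => trivial
  | succ h ih =>
    have hv : IsKFormula (h + 1 + 1) (var (h + 1) : Formula A) := Nat.lt_succ_self _
    exact ⟨hv, isKFormula_diaLe n ⟨⟨⟨isKFormula_diaLe n hv, trivial⟩,
      isKFormula_mono (by omega) ih⟩, trivial⟩, trivial⟩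

/-- The formulas of finite height are canonical. -/
lemma exists_subst_of_notMem_heightSet [Fintype A] (hL : IsLogic L) {n : ℕ} (hn : tr A n ∈ L)
    (h : ℕ) {w : World L} (hw : w ∉ heightSet RelAll h) :
    ∃ σ : ℕ → Formula A, ¬ w.holds ((heightForm A n h).subst σ) := by
  induction h generalizing w with
  | zero => exact ⟨var, w.not_bot⟩
  | succ h ih =>
    have hw' : ∃ v, Reach w v ∧ ¬ Reach v w ∧ v ∉ heightSet RelAll h := by
      by_contra! hcon
      exact hw fun v hv => or_iff_not_imp_left.2 fun h' => hcon v hv h'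
    obtain ⟨v, h1, h2, h3⟩ := hw'
    obtain ⟨σ, hσ⟩ := ih h3
    -- Since `w` is not reachable from `v`, some formula separates them; it becomes the value of
    -- `p_{h+1}`. This variable does not occur in `B_h`, so the refutation of `B_h` at `v` is not
    -- disturbed.
    have h4 : ∃ φ, w.holds φ ∧ ¬ v.holds (diaLe n φ) := by
      by_contra! hcon
      exact h2 (reach_of_forall_diaLe hL n hcon)
    obtain ⟨φ, h5, h6⟩ := h4
    refine ⟨Function.update σ (h + 1) φ, ?_⟩
    have h7 : (heightForm A n h).subst (Function.update σ (h + 1) φ) =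
        (heightForm A n h).subst σ :=
      subst_congr (isKFormula_heightForm n h) fun i hi => Function.update_of_ne hi.ne _ _
    simp only [heightForm_succ, subst, neg, Formula.or, subst_diaLe, h7, Function.update_self]
    simp only [World.holds_imp, World.holds_bot, imp_false, not_forall, not_not]
    refine ⟨h5, (World.holds_diaLe_of_tr hL hn _ _).2 ⟨v, h1, ?_⟩⟩
    simp only [World.holds_imp, World.holds_bot, imp_false]
    exact fun h' => hσ (h' h6)

end Canonical

/-! ### Local tabularity of the extensions of `L_m` of finite height. -/

section Unimodal

variable {L : Set (Formula Unit)} {m : ℕ}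

lemma holds_iff_of_bisimilar (hL : IsLogic L) {k : ℕ} {φ : Formula Unit} (hφ : IsKFormula k φ)
    {w v : World L} (h : Bisimilar RelAll (fun (w : World L) (i : Fin k) => w.holds (var i)) w v) :
    w.holds φ ↔ v.holds φ := by
  induction φ generalizing w v with
  | var n => exact Iff.of_eq (congrFun (isBisim_bisimilar _ _ _ _ h).1 ⟨n, hφ⟩)
  | bot => simp
  | imp φ ψ h1 h2 => rw [World.holds_imp, World.holds_imp, h1 hφ.1 h, h2 hφ.2 h]
  | dia a φ ih =>
    obtain ⟨-, h1, h2⟩ := isBisim_bisimilar _ _ _ _ h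
    rw [World.holds_dia hL, World.holds_dia hL]
    constructor
    · rintro ⟨u, h3, h4⟩
      obtain ⟨u', h5, h6⟩ := h1 u ⟨a, h3⟩
      exact ⟨u', relAll_unit_iff.1 h5, (ih hφ h6).1 h4⟩
    · rintro ⟨u, h3, h4⟩
      obtain ⟨u', h5, h6⟩ := h2 u ⟨a, h3⟩
      exact ⟨u', relAll_unit_iff.1 h5, (ih hφ h6).2 h4⟩

/-- By canonicity all worlds lie in `heightSet RelAll h`, which has finitely many types for the
colouring by `p_i`, `i < k`. A `k`-formula is determined, up to equivalence in `L`, by the set of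
types at which it is satisfied. -/
lemma locallyTabular_of_hasFiniteHeight (hL : IsLogic L) (hm : 0 < m)
    (hLm : imp ((dia ())^[m + 1] (var 0)) ((dia () (var 0)).or (var 0)) ∈ L)
    (hfh : HasFiniteHeight L) : LocallyTabular L := by
  intro k
  obtain ⟨n, h, hn, hh⟩ := hfh
  obtain ⟨T, _, τ, hτ⟩ := finitelyManyTypes_heightSet (R := RelAll (L := L)) hm
    (fun w v => relAll_or_eq_of_iter hL hLm)
    (fun (w : World L) (i : Fin k) => w.holds (var i)) h
  have huniv : ∀ w : World L, w ∈ heightSet RelAll h := by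
    intro w
    by_contra hw
    obtain ⟨σ, hσ⟩ := exists_subst_of_notMem_heightSet hL hn h hw
    exact hσ (w.of_mem _ (hL.subst σ _ hh))
  refine kFinite_of_finite hL (fun φ => {t : T | ∃ w : World L, τ w = t ∧ w.holds φ})
    fun φ ψ hφ hψ hφψ => (mem_iff_forall_world hL).2 fun w => ?_
  have key : ∀ χ, IsKFormula k χ →
      (w.holds χ ↔ τ w ∈ {t : T | ∃ w : World L, τ w = t ∧ w.holds χ}) := by
    intro χ hχ
    refine ⟨fun h' => ⟨w, rfl, h'⟩, ?_⟩
    rintro ⟨v, h1, h2⟩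
    exact (holds_iff_of_bisimilar hL hχ (hτ v (huniv v) w (huniv w) h1)).1 h2
  rw [World.holds_iff, key φ hφ, key ψ hψ]
  exact Iff.of_eq (congrArg (τ w ∈ ·) hφψ)

theorem admitsFiniteHeightCriterion_logicLm (hm : 0 < m) :
    AdmitsFiniteHeightCriterion (logicLm m) := by
  intro L hL hLm
  refine ⟨fun hlt => hlt.height_restrict_lt_top hL, fun hfh => ?_⟩
  refine locallyTabular_of_hasFiniteHeight hL hm (hLm (subset_smallestLogic _ rfl)) ?_
  -- Only the restriction to the full subalphabet is needed; it is `L` over a copy of the alphabet.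
  exact HasFiniteHeight.of_pull (f := (Subtype.val : {a // a ∈ (Finset.univ : Finset Unit)} → Unit)) hL
    (fun a => ⟨⟨a, Finset.mem_univ a⟩, rfl⟩)
    ((height_lt_top_iff (isLogic_restrict hL _)).1 (hfh Finset.univ))

end Unimodal

end ModalFH

theorem mainTheorem10 :
    (∀ (A : Type u) [Fintype A] (L : Set (ModalFH.Formula A)), ModalFH.IsLogic L →
      (ModalFH.AdmitsFiniteHeightCriterion (ModalFH.diff L) ↔
        ModalFH.AdmitsFiniteHeightCriterion L)) ∧
    ∀ m : ℕ, 0 < m →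
      ModalFH.AdmitsFiniteHeightCriterion (ModalFH.diff (ModalFH.logicLm m)) :=
  ⟨fun _ _ _ _ => ModalFH.admitsFiniteHeightCriterion_diff_iff,
    fun _ hm => ModalFH.admitsFiniteHeightCriterion_diff_iff.2
      (ModalFH.admitsFiniteHeightCriterion_logicLm hm)⟩
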